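/- Let $M$ be an $n$-dimensional smooth manifold (Hausdorff, second countable, without boundary) with a smooth positive density $\mathrm{vol}$, let $E,F\to M$ be smooth real vector bundles of finite rank, and let $L:C^\infty(M,E)\to C^\infty(M,F)$ be a linear differential operator of order (at most) $k$, where $k\ge 1$. For $\Omega\subset M$ open, let $\mathcal D(\Omega,E^*)$ be the space of smooth sections of $E^*$ with compact support in $\Omega$ and $\mathcal D'(\Omega,E)$ the space of distributional sections, i.e. of continuous linear functionals on $\mathcal D(\Omega,E^*)$. A section $s\in C^\infty(\Omega,E)$ is identified with the functional $\phi\mapsto\int_\Omega\langle s,\phi\rangle\,\mathrm{vol}$. For $T\in\mathcal D'(\Omega,E)$ define $LT\in\mathcal D'(\Omega,F)$ by $(LT)[\phi]=T[L^*\phi]$, where $L^*$ is the formally dual operator, characterized by $\int_M\langle Lv,\phi\rangle\,\mathrm{vol}=\int_M\langle v,L^*\phi\rangle\,\mathrm{vol}$ for all $v\in C^\infty(M,E)$ and all compactly supported $\phi\in C^\infty(M,F^*)$. Assume that $L$ is weakly hypoelliptic: for every open $\Omega\subset M$, every $T\in\mathcal D'(\Omega,E)$ with $LT=0$ is smooth.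 Let $S\subset M$ be an embedded submanifold of codimension $m\ge k+1$ which is closed as a subset of $M$. Let $u\in C^\infty(M\setminus S,E)$ satisfy $Lu=0$ on $M\setminus S$ and be locally bounded near $S$: every point of $S$ has a neighborhood $U$ such that $u$ is bounded on $U\setminus S$ (with respect to a local trivialization of $E$ near the point). Then there is a unique $\bar u\in C^\infty(M,E)$ with $L\bar u=0$ on $M$ and $\bar u=u$ on $M\setminus S$. -/

import Mathlib

open Set Filter Topology MeasureTheory Bundle Manifold
open scoped ContDiff

noncomputable section

/-- A smooth positive density on the `n`-dimensional manifold `M`, seen as a measure: in every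
smooth chart it is a smooth positive function times Lebesgue measure. -/
def IsSmoothPositiveDensity (n : ℕ) {M : Type*} [TopologicalSpace M]
    [ChartedSpace (EuclideanSpace ℝ (Fin n)) M] [MeasurableSpace M] (vol : Measure M) : Prop :=
  ∀ e ∈ IsManifold.maximalAtlas (𝓡 n) ∞ M,
    ∃ ρ : EuclideanSpace ℝ (Fin n) → ℝ,
      ContDiffOn ℝ ∞ ρ e.target ∧ (∀ y ∈ e.target, 0 < ρ y) ∧
      (vol.restrict e.source).map e =
        (volume.restrict e.target).withDensity (fun y => ENNReal.ofReal (ρ y))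

/-- `S` is an embedded submanifold of codimension `m` of the `n`-dimensional manifold `M`: around
each of its points there is a smooth chart of `M` in which `S` is given by the vanishing of the
first `m` coordinates. -/
def IsEmbeddedSubmanifoldOfCodim (n : ℕ) {M : Type*} [TopologicalSpace M]
    [ChartedSpace (EuclideanSpace ℝ (Fin n)) M] (S : Set M) (m : ℕ) : Prop :=
  m ≤ n ∧ ∀ p ∈ S, ∃ e ∈ IsManifold.maximalAtlas (𝓡 n) ∞ M, p ∈ e.source ∧
    ∀ x ∈ e.source, x ∈ S ↔ ∀ i : Fin n, (i : ℕ) < m → e x i = 0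

section Bundles

variable {n : ℕ} {M : Type*} [TopologicalSpace M] [ChartedSpace (EuclideanSpace ℝ (Fin n)) M]

section Local

variable (n) (V : Type*) [NormedAddCommGroup V] [NormedSpace ℝ V]
  (E : M → Type*) [TopologicalSpace (TotalSpace V E)] [∀ x, TopologicalSpace (E x)]
  [FiberBundle V E]

/-- The open set around `x₀` on which both the preferred chart of `M` and the preferred
trivialization of the bundle `E` at `x₀` are defined. -/
def localDomain (x₀ : M) : Set M :=
  (chartAt (EuclideanSpace ℝ (Fin n)) x₀).source ∩ (trivializationAt V E x₀).baseSet

variable {E}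

/-- The section `s` of `E` written in the preferred chart and trivialization at `x₀`: a `V`-valued
function of the coordinates, meaningful on the image of `localDomain n V E x₀`. -/
def localRep (s : ∀ x, E x) (x₀ : M) (y : EuclideanSpace ℝ (Fin n)) : V :=
  let x := (chartAt (EuclideanSpace ℝ (Fin n)) x₀).symm y
  (trivializationAt V E x₀ (TotalSpace.mk' V x (s x))).2

/-- Smoothness on a set of a section of `E`. -/
def IsSmoothSectionOn (s : ∀ x, E x) (A : Set M) : Prop :=
  ContMDiffOn (𝓡 n) ((𝓡 n).prod 𝓘(ℝ, V)) ∞ (fun x => TotalSpace.mk' V x (s x)) A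

/-- The section `u`, given away from `S`, is locally bounded near `S`: every point of `S` has a
neighborhood `U` such that `u` is bounded on `U \ S` (in a local trivialization at the point). -/
def IsLocallyBoundedNear (u : ∀ x, E x) (S : Set M) : Prop :=
  ∀ p ∈ S, ∃ C : ℝ, ∀ᶠ x in 𝓝 p, x ∉ S →
    ‖(trivializationAt V E p (TotalSpace.mk' V x (u x))).2‖ ≤ C

end Local

section DiffOp

variable {V : Type*} [NormedAddCommGroup V] [NormedSpace ℝ V]
  {E : M → Type*} [TopologicalSpace (TotalSpace V E)] [∀ x, AddCommGroup (E x)]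
  [∀ x, Module ℝ (E x)] [∀ x, TopologicalSpace (E x)] [FiberBundle V E] [VectorBundle ℝ V E]
  {W : Type*} [NormedAddCommGroup W] [NormedSpace ℝ W]
  {F : M → Type*} [TopologicalSpace (TotalSpace W F)] [∀ x, AddCommGroup (F x)]
  [∀ x, Module ℝ (F x)] [∀ x, TopologicalSpace (F x)] [FiberBundle W F] [VectorBundle ℝ W F]

/-- `L : C^∞(M, E) → C^∞(M, F)` is a linear differential operator of order (at most) `k`:
in local coordinates, `(L u)(y) = ∑_{j ≤ k} a_j(y) (D^j u(y))`, where the coefficient `a_j(y)` is a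
linear map from `V`-valued `j`-linear forms on `ℝⁿ` to `W`, smooth in `y`. -/
def IsDiffOpOfOrder (L : Cₛ^∞⟮𝓡 n; V, E⟯ →ₗ[ℝ] Cₛ^∞⟮𝓡 n; W, F⟯) (k : ℕ) : Prop :=
  ∀ x₀ : M, ∃ a : ∀ j : ℕ, EuclideanSpace ℝ (Fin n) →
      ((EuclideanSpace ℝ (Fin n) [×j]→L[ℝ] V) →L[ℝ] W),
    (∀ j, ContDiffOn ℝ ∞ (a j)
      (chartAt (EuclideanSpace ℝ (Fin n)) x₀ '' (localDomain n V E x₀ ∩ localDomain n W F x₀))) ∧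
    ∀ u : Cₛ^∞⟮𝓡 n; V, E⟯,
      ∀ y ∈ chartAt (EuclideanSpace ℝ (Fin n)) x₀ ''
          (localDomain n V E x₀ ∩ localDomain n W F x₀),
        localRep n W (L u) x₀ y =
          ∑ j ∈ Finset.range (k + 1), a j y (iteratedFDeriv ℝ j (localRep n V u x₀) y)

/-- `u`, a section of `E` of which only the restriction to the open set `Ω` matters, is a smooth
solution of `L u = 0` on `Ω`. As `L` is local, `(L u)(x)` for `x ∈ Ω` is `(L v)(x)` for any
global smooth section `v` that agrees with `u` near `x`. -/
def IsSmoothSolutionOn (L : Cₛ^∞⟮𝓡 n; V, E⟯ →ₗ[ℝ] Cₛ^∞⟮𝓡 n; W, F⟯) (Ω : Set M)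
    (u : ∀ x, E x) : Prop :=
  IsSmoothSectionOn n V u Ω ∧
    ∀ x ∈ Ω, ∀ v : Cₛ^∞⟮𝓡 n; V, E⟯, (∀ᶠ y in 𝓝 x, v y = u y) → L v x = 0

end DiffOp

section Distributions

variable (n) (V : Type*) [NormedAddCommGroup V] [NormedSpace ℝ V]
  (E : M → Type*) [TopologicalSpace (TotalSpace V E)] [∀ x, AddCommGroup (E x)]
  [∀ x, Module ℝ (E x)] [∀ x, TopologicalSpace (E x)] [FiberBundle V E] [VectorBundle ℝ V E]

/-- Smooth sections over `M` of the dual bundle `E*`. -/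
abbrev DualSection : Type _ :=
  Cₛ^∞⟮𝓡 n; V →L[ℝ] ℝ, fun x : M => E x →L[ℝ] Bundle.Trivial M ℝ x⟯

/-- The space `𝒟(Ω, E*)` of test sections on the open set `Ω`: smooth sections of `E*` which vanish
outside a compact subset of `Ω`. -/
def TestSection (Ω : Set M) : Submodule ℝ (DualSection n V E) where
  carrier := {φ | ∃ K : Set M, IsCompact K ∧ K ⊆ Ω ∧ ∀ x ∉ K, φ x = 0}
  zero_mem' := ⟨∅, isCompact_empty, empty_subset _, fun _ _ => rfl⟩
  add_mem' := by
    rintro φ ψ ⟨K, hK, hKΩ, hφ⟩ ⟨K', hK', hKΩ', hψ⟩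
    refine ⟨K ∪ K', hK.union hK', union_subset hKΩ hKΩ', fun x hx => ?_⟩
    rw [mem_union, not_or] at hx
    rw [ContMDiffSection.coe_add, Pi.add_apply, hφ x hx.1, hψ x hx.2, add_zero]
  smul_mem' := by
    rintro c φ ⟨K, hK, hKΩ, hφ⟩
    refine ⟨K, hK, hKΩ, fun x hx => ?_⟩
    rw [ContMDiffSection.coe_smul, Pi.smul_apply, hφ x hx, smul_zero]

/-- The space `𝒟'(Ω, E)` of distributional sections of `E` on the open set `Ω`: linear functionals
on `𝒟(Ω, E*)` satisfying, for each compact `K ⊆ Ω` contained in the domain of a local chart and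
trivialization, an estimate `|T φ| ≤ C ‖φ‖_{C^N(K)}` for the test sections `φ` supported in `K`. -/
structure DistributionalSection (Ω : Set M) where
  /-- the functional -/
  toLinearMap : TestSection n V E Ω →ₗ[ℝ] ℝ
  /-- continuity -/
  continuous' : ∀ (x₀ : M) (K : Set M), IsCompact K → K ⊆ Ω →
    K ⊆ localDomain n (V →L[ℝ] ℝ) (fun x : M => E x →L[ℝ] Bundle.Trivial M ℝ x) x₀ →
    ∃ (C : ℝ) (N : ℕ), ∀ φ : TestSection n V E Ω, (∀ x ∉ K, φ.1 x = 0) →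
      ∀ B : ℝ, 0 ≤ B →
        (∀ j ≤ N, ∀ x ∈ K, ‖iteratedFDeriv ℝ j (localRep n (V →L[ℝ] ℝ) φ.1 x₀)
          (chartAt (EuclideanSpace ℝ (Fin n)) x₀ x)‖ ≤ B) →
        |toLinearMap φ| ≤ C * B

variable {n V E}

/-- The distributional section `T` on `Ω` is smooth: it is given by integration against a section
of `E` which is smooth on `Ω`. -/
def DistributionalSection.IsSmooth [MeasurableSpace M] (vol : Measure M) {Ω : Set M}
    (T : DistributionalSection n V E Ω) : Prop :=
  ∃ s : ∀ x, E x, IsSmoothSectionOn n V s Ω ∧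
    ∀ φ : TestSection n V E Ω, T.toLinearMap φ = ∫ x in Ω, (φ.1 x (s x) : ℝ) ∂vol

variable {W : Type*} [NormedAddCommGroup W] [NormedSpace ℝ W]
  {F : M → Type*} [TopologicalSpace (TotalSpace W F)] [∀ x, AddCommGroup (F x)]
  [∀ x, Module ℝ (F x)] [∀ x, TopologicalSpace (F x)] [FiberBundle W F] [VectorBundle ℝ W F]

/-- `ψ = L* φ` for the formally dual operator `L*` of `L` (with respect to `vol`), `φ` being a
compactly supported section of `F*`: this is characterized by
`∫ ⟨L v, φ⟩ vol = ∫ ⟨v, ψ⟩ vol` for all smooth sections `v` of `E`. -/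
def IsFormalDualValue [MeasurableSpace M] (vol : Measure M)
    (L : Cₛ^∞⟮𝓡 n; V, E⟯ →ₗ[ℝ] Cₛ^∞⟮𝓡 n; W, F⟯)
    (φ : DualSection n W F) (ψ : DualSection n V E) : Prop :=
  ∀ v : Cₛ^∞⟮𝓡 n; V, E⟯, ∫ x, (φ x (L v x) : ℝ) ∂vol = ∫ x, (ψ x (v x) : ℝ) ∂vol

/-- `L T = 0` on `Ω` in the sense of distributions, that is, `T[L* φ] = 0` for every test section
`φ ∈ 𝒟(Ω, F*)`. -/
def DistributionalSection.IsSolution [MeasurableSpace M] (vol : Measure M)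
    (L : Cₛ^∞⟮𝓡 n; V, E⟯ →ₗ[ℝ] Cₛ^∞⟮𝓡 n; W, F⟯) {Ω : Set M}
    (T : DistributionalSection n V E Ω) : Prop :=
  ∀ (φ : TestSection n W F Ω) (ψ : TestSection n V E Ω),
    IsFormalDualValue vol L φ.1 ψ.1 → T.toLinearMap ψ = 0

/-- `L` is weakly hypoelliptic: on every open set, every distributional solution of `L T = 0`
is smooth. -/
def IsWeaklyHypoelliptic [MeasurableSpace M] (vol : Measure M)
    (L : Cₛ^∞⟮𝓡 n; V, E⟯ →ₗ[ℝ] Cₛ^∞⟮𝓡 n; W, F⟯) : Prop :=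
  ∀ Ω : Set M, IsOpen Ω → ∀ T : DistributionalSection n V E Ω,
    T.IsSolution vol L → T.IsSmooth vol

end Distributions

end Bundles

end

/-! Since `S` is a null set and `u` is locally bounded, integration against `u` defines a
distribution `T` of order zero on all of `M`. If `L T = 0`, weak hypoellipticity makes `T` a smooth
section. That section agrees with `u` off `S` by the fundamental lemma of the calculus of
variations, and both `L ubar = 0` and uniqueness follow by continuity from the density of the
complement of `S`.

To see that `L T = 0`, let `ψ` be a formal dual value of `φ` and let `v = χ u`, where `χ` vanishes
near `S` and equals `1` near the complement of a small neighborhood `N` of `S`. Then `∫ ψ(u) = ∫ φ(L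
v) + ∫ ψ(u - v)`. The last integral is small because `ψ(u)` is integrable and `S` is null
(`MeasureTheory.Integrable.exists_isOpen_setIntegral_norm_le`).

For `∫ φ(L v)`, nothing is known about the derivatives of `χ`, and nothing is needed. `L v` vanishes
off `N`, so locally the test function may be multiplied by a cutoff `η(q/δ)` that is `1` on the part
of `N` that matters, where `q` collects the `m` coordinates defining `S`. Integrating by parts moves
all derivatives from `v` onto the test side at a cost of `δ⁻ᵏ`; what remains of `v` is bounded by
`u`, and the integrand lives on a tube of volume `O(δᵐ)`. The total is `O(δ^(m-k))`, which tends to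
zero because `m ≥ k + 1`. This is `exists_abs_integral_diffOp_le_of_tube`, carried to the manifold
by `exists_nhds_abs_integral_cutoff_le` and globalized by a partition of unity. As `χ` needs no
adaptation to charts, one global cutoff serves all of them. -/

noncomputable section

set_option linter.unusedSectionVars false

/-! ### Integration by parts for iterated derivatives on `ℝⁿ` -/

section Euclidean

variable {n : ℕ}

/-- The inclusion of `V`-valued `j`-linear forms into `(j + 1)`-linear forms given by multiplication
with the `i`-th coordinate of the first variable. -/
def coordMul (n : ℕ) (V : Type*) [NormedAddCommGroup V] [NormedSpace ℝ V] (j : ℕ) (i : Fin n) :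
    (EuclideanSpace ℝ (Fin n) [×j]→L[ℝ] V) →L[ℝ] (EuclideanSpace ℝ (Fin n) [×(j + 1)]→L[ℝ] V) :=
  ((continuousMultilinearCurryLeftEquiv ℝ (fun _ : Fin (j + 1) => EuclideanSpace ℝ (Fin n))
      V).symm.toContinuousLinearEquiv : _ →L[ℝ] _) ∘L
    ContinuousLinearMap.smulRightL ℝ (EuclideanSpace ℝ (Fin n)) _
      (EuclideanSpace.proj i : EuclideanSpace ℝ (Fin n) →L[ℝ] ℝ)

/-- Expanding the first argument in the standard basis isolates the outermost derivative as
directional derivatives followed by constant linear maps, the shape in which it can be integrated by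
parts. -/
theorem iteratedFDeriv_succ_eq_sum_coordMul {V : Type*} [NormedAddCommGroup V] [NormedSpace ℝ V]
    (w : EuclideanSpace ℝ (Fin n) → V) (j : ℕ) (y : EuclideanSpace ℝ (Fin n)) :
    iteratedFDeriv ℝ (j + 1) w y = ∑ i, coordMul n V j i
      (fderiv ℝ (iteratedFDeriv ℝ j w) y (EuclideanSpace.single i 1)) := by
  ext v
  rw [iteratedFDeriv_succ_apply_left, sum_apply]
  have : v 0 = ∑ i, v 0 i • EuclideanSpace.single i (1 : ℝ) := by
    ext k
    simp [Finset.sum_apply, Pi.single_apply]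
  conv_lhs => rw [this]
  rw [map_sum, sum_apply]
  refine Finset.sum_congr rfl fun i _ => ?_
  rw [map_smul]
  rfl

section Transpose

variable {H X Y : Type*} [NormedAddCommGroup H] [NormedSpace ℝ H] [NormedAddCommGroup X]
  [NormedSpace ℝ X] [NormedAddCommGroup Y] [NormedSpace ℝ Y]

set_option synthInstance.maxHeartbeats 200000 in
theorem exists_norm_iteratedFDeriv_clm_fderiv_le (Ψ : X →L[ℝ] Y) (v : H) (j : ℕ) :
    ∃ c : ℝ, 0 ≤ c ∧ ∀ b : H → X, ContDiff ℝ ∞ b → ∀ y,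
      ‖iteratedFDeriv ℝ j (fun y => Ψ (fderiv ℝ b y v)) y‖ ≤ c * ‖iteratedFDeriv ℝ (j + 1) b y‖ := by
  let Θ : (H →L[ℝ] X) →L[ℝ] Y := Ψ ∘L ContinuousLinearMap.apply ℝ X v
  refine ⟨‖Θ‖, Θ.opNorm_nonneg, fun b hb y => ?_⟩
  have hdb : ContDiff ℝ ∞ (fderiv ℝ b) := hb.fderiv_right (by simp)
  have hle : (j : ℕ∞ω) ≤ ∞ := by exact_mod_cast le_top
  refine (Θ.norm_iteratedFDeriv_comp_left hdb.contDiffAt hle).trans ?_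
  rw [norm_iteratedFDeriv_fderiv]

theorem ContDiff.clm_fderiv {b : H → X} (hb : ContDiff ℝ ∞ b) (Ψ : X →L[ℝ] Y) (v : H) :
    ContDiff ℝ ∞ fun y => Ψ (fderiv ℝ b y v) :=
  Ψ.contDiff.comp ((hb.fderiv_right (m := ∞) (by simp)).clm_apply contDiff_const)

theorem fderiv_eq_zero_of_notMem_of_isClosed {b : H → Y} {Z : Set H} (hZ : IsClosed Z)
    (hbZ : ∀ y ∉ Z, b y = 0) {y : H} (hy : y ∉ Z) : fderiv ℝ b y = 0 := by
  have : b =ᶠ[𝓝 y] fun _ => 0 := by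
    filter_upwards [hZ.isOpen_compl.mem_nhds hy] with z hz using hbZ z hz
  rw [this.fderiv_eq]
  simp

theorem clm_fderiv_eq_zero_of_notMem_of_isClosed {b : H → X} {Z : Set H} (hZ : IsClosed Z)
    (hbZ : ∀ y ∉ Z, b y = 0) {y : H} (hy : y ∉ Z) (Ψ : X →L[ℝ] Y) (v : H) :
    Ψ (fderiv ℝ b y v) = 0 := by
  rw [fderiv_eq_zero_of_notMem_of_isClosed hZ hbZ hy]
  simp

theorem integral_bilinear_fderiv_eq_neg_of_isCompact [MeasurableSpace H] [BorelSpace H]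
    [FiniteDimensional ℝ H] (μ : Measure H) [μ.IsAddHaarMeasure] (B : X →L[ℝ] Y →L[ℝ] ℝ) (v : H)
    {b : H → X} (hb : ContDiff ℝ ∞ b) {g : H → Y} (hg : ContDiff ℝ ∞ g) {Z : Set H}
    (hZ : IsCompact Z) (hbZ : ∀ y ∉ Z, b y = 0) :
    ∫ y, B (b y) (fderiv ℝ g y v) ∂μ = - ∫ y, B (fderiv ℝ b y v) (g y) ∂μ := by
  have hdb : Continuous fun y => fderiv ℝ b y v :=
    ((hb.fderiv_right (m := 0) (by simp)).clm_apply contDiff_const).continuous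
  have hdg : Continuous fun y => fderiv ℝ g y v :=
    ((hg.fderiv_right (m := 0) (by simp)).clm_apply contDiff_const).continuous
  have hint : ∀ (f : H → X) (h : H → Y), Continuous f → Continuous h → (∀ y ∉ Z, f y = 0) →
      Integrable (fun y => B (f y) (h y)) μ := fun f h hf hh hfZ =>
    ((B.continuous.comp hf).clm_apply hh).integrable_of_hasCompactSupport
      (HasCompactSupport.intro hZ fun y hy => by simp [hfZ y hy])
  exact integral_bilinear_fderiv_right_eq_neg_left_of_integrable
    (hint _ _ hdb hg.continuous fun y hy => by
      rw [fderiv_eq_zero_of_notMem_of_isClosed hZ.isClosed hbZ hy]; rfl)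
    (hint _ _ hb.continuous hdg hbZ) (hint _ _ hb.continuous hg.continuous hbZ)
    (fun y _ => hb.differentiable (by simp) y) (fun y _ => hg.differentiable (by simp) y)

/-- The inductive step for moving derivatives: one integration by parts replaces `b` by transposes
of `J i` applied to its directional derivatives, so a bound on `j + 1` derivatives of `b` becomes a
bound on `j` derivatives of the new coefficients. The factor `c` depends only on `J`, `v` and `j`.
-/
theorem exists_abs_integral_sum_fderiv_le [MeasurableSpace H] [BorelSpace H]
    [FiniteDimensional ℝ H] (μ : Measure H) [μ.IsAddHaarMeasure] {ι : Type*} [Fintype ι]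
    (J : ι → X →L[ℝ] Y) (v : ι → H) (j : ℕ) :
    ∃ c : ℝ, 0 ≤ c ∧ ∀ (G : H → X) (Z : Set H) (C : ℝ), ContDiff ℝ ∞ G → IsCompact Z →
      (∀ (b : H → X →L[ℝ] ℝ) (B : ℝ), ContDiff ℝ ∞ b → (∀ y ∉ Z, b y = 0) →
        (∀ y, ‖iteratedFDeriv ℝ j b y‖ ≤ B) → |∫ y, b y (G y) ∂μ| ≤ C * B) →
      ∀ (b : H → Y →L[ℝ] ℝ) (B : ℝ), ContDiff ℝ ∞ b → (∀ y ∉ Z, b y = 0) →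
        (∀ y, ‖iteratedFDeriv ℝ (j + 1) b y‖ ≤ B) →
        |∫ y, b y (∑ i, J i (fderiv ℝ G y (v i))) ∂μ| ≤ C * (c * B) := by
  let Ψ : ι → (Y →L[ℝ] ℝ) →L[ℝ] (X →L[ℝ] ℝ) := fun i =>
    (ContinuousLinearMap.compL ℝ X Y ℝ).flip (J i)
  choose c hc0 hc using fun i => exists_norm_iteratedFDeriv_clm_fderiv_le (Ψ i) (v i) j
  refine ⟨∑ i, c i, Finset.sum_nonneg fun i _ => hc0 i,
    fun G Z C hG hZ ih b B hb hbZ hB => ?_⟩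
  have hdG : ContDiff ℝ ∞ (fderiv ℝ G) := hG.fderiv_right (by simp)
  have hparts : ∀ i, ∫ y, b y (J i (fderiv ℝ G y (v i))) ∂μ =
      - ∫ y, Ψ i (fderiv ℝ b y (v i)) (G y) ∂μ := fun i =>
    integral_bilinear_fderiv_eq_neg_of_isCompact μ (Ψ i) (v i) hb hG hZ hbZ
  have hint : ∀ i, Integrable (fun y => b y (J i (fderiv ℝ G y (v i)))) μ := fun i =>
    (hb.continuous.clm_apply ((J i).continuous.comp
      (hdG.continuous.clm_apply continuous_const))).integrable_of_hasCompactSupport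
      (HasCompactSupport.intro hZ fun y hy => by rw [hbZ y hy]; rfl)
  have hsum : ∫ y, b y (∑ i, J i (fderiv ℝ G y (v i))) ∂μ =
      ∑ i, - ∫ y, Ψ i (fderiv ℝ b y (v i)) (G y) ∂μ := by
    simp_rw [map_sum]
    rw [integral_finsetSum _ fun i _ => hint i]
    exact Finset.sum_congr rfl fun i _ => hparts i
  rw [hsum, Finset.sum_mul, Finset.mul_sum]
  refine (Finset.abs_sum_le_sum_abs _ _).trans (Finset.sum_le_sum fun i _ => ?_)
  rw [abs_neg]
  exact ih _ (c i * B) (hb.clm_fderiv _ _)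
    (fun y hy => clm_fderiv_eq_zero_of_notMem_of_isClosed hZ.isClosed hbZ hy _ _)
    fun y => (hc i b hb y).trans (mul_le_mul_of_nonneg_left (hB y) (hc0 i))

end Transpose

/-- After `j` integrations by parts only the size of `w` on `Z` enters, not its derivatives. That
`C` is chosen before `b`, `w` and `Z` is essential: later all three vary with `δ` and with the
cutoff. -/
theorem exists_abs_integral_iteratedFDeriv_le {V : Type*} [NormedAddCommGroup V] [NormedSpace ℝ V]
    (j : ℕ) :
    ∃ C : ℝ, 0 ≤ C ∧
      ∀ (b : EuclideanSpace ℝ (Fin n) → (EuclideanSpace ℝ (Fin n) [×j]→L[ℝ] V) →L[ℝ] ℝ)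
      (w : EuclideanSpace ℝ (Fin n) → V) (Z : Set (EuclideanSpace ℝ (Fin n))) (A B : ℝ),
      ContDiff ℝ ∞ b → ContDiff ℝ ∞ w → IsCompact Z → (∀ y ∉ Z, b y = 0) →
      (∀ y ∈ Z, ‖w y‖ ≤ A) → (∀ y, ‖iteratedFDeriv ℝ j b y‖ ≤ B) →
      |∫ y, b y (iteratedFDeriv ℝ j w y)| ≤ C * B * A * volume.real Z := by
  induction j with
  | zero =>
    refine ⟨1, zero_le_one, fun b w Z A B hb hw hZ hbZ hA hB => ?_⟩
    have hbB : ∀ y, ‖b y‖ ≤ B := fun y => by simpa using hB y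
    have hB0 : 0 ≤ B := (norm_nonneg (b 0)).trans (hbB 0)
    have : ∫ y, b y (iteratedFDeriv ℝ 0 w y) = ∫ y in Z, b y (iteratedFDeriv ℝ 0 w y) := by
      rw [setIntegral_eq_integral_of_forall_compl_eq_zero]
      intro y hy
      rw [hbZ y hy]; rfl
    rw [this, ← Real.norm_eq_abs]
    refine (norm_setIntegral_le_of_norm_le_const (C := B * A) hZ.measure_lt_top
      fun y hy => ?_).trans_eq (by ring)
    refine ((b y).le_opNorm _).trans ?_
    have h1 := hA y hy
    have h2 : ‖iteratedFDeriv ℝ 0 w y‖ = ‖w y‖ := by simp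
    rw [h2]
    exact mul_le_mul (hbB y) h1 (norm_nonneg _) hB0
  | succ j ih =>
    obtain ⟨C, hC, ih⟩ := ih
    obtain ⟨c, hc, h⟩ := exists_abs_integral_sum_fderiv_le
      (volume : Measure (EuclideanSpace ℝ (Fin n))) (coordMul n V j)
      (fun i => EuclideanSpace.single i (1 : ℝ)) j
    refine ⟨C * c, mul_nonneg hC hc, fun b w Z A B hb hw hZ hbZ hA hB => ?_⟩
    simp_rw [iteratedFDeriv_succ_eq_sum_coordMul]
    have hG : ContDiff ℝ ∞ (iteratedFDeriv ℝ j w) := hw.iteratedFDeriv_right (i := j) (m := ∞) (by exact_mod_cast le_top)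
    exact (h (iteratedFDeriv ℝ j w) Z (C * A * volume.real Z) hG hZ
      (fun b B hb hbZ hB => (ih b w Z A B hb hw hZ hbZ hA hB).trans_eq (by ring)) b B hb hbZ
      hB).trans_eq (by ring)

end Euclidean

/-! ### Smooth extension by zero, and derivative bounds for rescaled cutoffs -/

section SmoothExtension

variable {X : Type*} [NormedAddCommGroup X] [NormedSpace ℝ X]
  {Y : Type*} [NormedAddCommGroup Y] [NormedSpace ℝ Y]

theorem ContDiffOn.contDiff_indicator {f : X → Y} {O Z : Set X} (hf : ContDiffOn ℝ ∞ f O)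
    (hO : IsOpen O) (hZ : IsClosed Z) (hZO : Z ⊆ O) (h0 : ∀ y ∈ O, y ∉ Z → f y = 0) :
    ContDiff ℝ ∞ (O.indicator f) := by
  rw [contDiff_iff_contDiffAt]
  intro y
  by_cases hy : y ∈ O
  · refine (hf.contDiffAt (hO.mem_nhds hy)).congr_of_eventuallyEq ?_
    filter_upwards [hO.mem_nhds hy] with z hz using indicator_of_mem hz f
  · refine (contDiffAt_const (c := (0 : Y))).congr_of_eventuallyEq ?_
    filter_upwards [hZ.isOpen_compl.mem_nhds (fun h => hy (hZO h))] with z hz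
    by_cases hzO : z ∈ O
    · rw [indicator_of_mem hzO, h0 z hzO hz]
    · rw [indicator_of_notMem hzO]

/-- Multiply by a smooth function that is `1` near `Z` and supported in a compact subset of `O`.
Agreement near `Z`, not only on it, makes all derivatives agree on `Z`. -/
theorem ContDiffOn.exists_contDiff_eq_nhdsSet [FiniteDimensional ℝ X] {f : X → Y} {O Z : Set X}
    (hf : ContDiffOn ℝ ∞ f O) (hO : IsOpen O) (hZ : IsCompact Z) (hZO : Z ⊆ O) :
    ∃ g : X → Y, ContDiff ℝ ∞ g ∧ HasCompactSupport g ∧ ∀ᶠ y in 𝓝ˢ Z, g y = f y := by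
  obtain ⟨K, hK, hZK, hKO⟩ := exists_compact_between hZ hO hZO
  obtain ⟨κ, hκ1, hκ0, -⟩ :=
    exists_contMDiffMap_one_nhds_of_subset_interior 𝓘(ℝ, X) (n := ⊤) hZ.isClosed hZK
  have hκ : ContDiff ℝ ∞ κ := κ.contMDiff.contDiff
  refine ⟨O.indicator fun y => κ y • f y, ?_, ?_, ?_⟩
  · exact (hκ.contDiffOn.smul hf).contDiff_indicator hO hK.isClosed hKO
      fun y _ hy => by rw [Pi.smul_apply', hκ0 y hy, zero_smul]
  · refine HasCompactSupport.intro hK fun y hy => ?_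
    by_cases hyO : y ∈ O
    · rw [indicator_of_mem hyO, hκ0 y hy, zero_smul]
    · rw [indicator_of_notMem hyO]
  · filter_upwards [hκ1, hO.mem_nhdsSet.mpr hZO] with y hy hyO
    rw [indicator_of_mem hyO, hy, one_smul]

theorem ContDiff.exists_norm_iteratedFDeriv_le {f : X → Y} (hf : ContDiff ℝ ∞ f)
    (hs : HasCompactSupport f) (N : ℕ) :
    ∃ C : ℝ, 1 ≤ C ∧ ∀ j ≤ N, ∀ y, ‖iteratedFDeriv ℝ j f y‖ ≤ C := by
  have : ∀ j : ℕ, ∃ C, ∀ y, ‖iteratedFDeriv ℝ j f y‖ ≤ C := fun j =>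
    (hf.continuous_iteratedFDeriv (m := j) (by exact_mod_cast le_top)).bounded_above_of_compact_support
      (hs.iteratedFDeriv j)
  choose C hC using this
  refine ⟨1 + ∑ j ∈ Finset.range (N + 1), |C j|, le_add_of_nonneg_right (by positivity),
    fun j hj y => ?_⟩
  calc ‖iteratedFDeriv ℝ j f y‖ ≤ |C j| := (hC j y).trans (le_abs_self _)
    _ ≤ ∑ j ∈ Finset.range (N + 1), |C j| :=
      Finset.single_le_sum (f := fun j => |C j|) (fun _ _ => abs_nonneg _)
        (Finset.mem_range.mpr (by omega))
    _ ≤ _ := by linarith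

/-- By the chain and Leibniz rules each derivative falling on the rescaled cutoff costs one factor
`δ⁻¹`; since `δ ≤ 1`, all orders up to `N` are absorbed into `δ⁻¹ ^ N`. -/
theorem exists_norm_iteratedFDeriv_scaled_smul_le {G : Type*} [NormedAddCommGroup G]
    [NormedSpace ℝ G] {η : G → ℝ} (hη : ContDiff ℝ ∞ η) (hηs : HasCompactSupport η)
    {q : X → G} (hq : ContDiff ℝ ∞ q) (hqs : HasCompactSupport q)
    {b : X → Y} (hb : ContDiff ℝ ∞ b) (hbs : HasCompactSupport b) (N : ℕ) :
    ∃ C : ℝ, 0 ≤ C ∧ ∀ j ≤ N, ∀ δ : ℝ, 0 < δ → δ ≤ 1 → ∀ y,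
      ‖iteratedFDeriv ℝ j (fun y => η (δ⁻¹ • q y) • b y) y‖ ≤ C * δ⁻¹ ^ N := by
  obtain ⟨C₁, h₁, hC₁⟩ := hη.exists_norm_iteratedFDeriv_le hηs N
  obtain ⟨C₂, h₂, hC₂⟩ := hq.exists_norm_iteratedFDeriv_le hqs N
  obtain ⟨C₃, h₃, hC₃⟩ := hb.exists_norm_iteratedFDeriv_le hbs N
  refine ⟨∑ j ∈ Finset.range (N + 1), ∑ i ∈ Finset.range (j + 1),
    (j.choose i : ℝ) * (i.factorial * C₁ * C₂ ^ i) * C₃, by positivity, ?_⟩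
  intro j hj δ hδ hδ1 y
  have hδ' : 1 ≤ δ⁻¹ := (one_le_inv₀ hδ).mpr hδ1
  have hcomp : ∀ i ≤ N, ‖iteratedFDeriv ℝ i (fun y => η (δ⁻¹ • q y)) y‖ ≤
      i.factorial * C₁ * C₂ ^ i * δ⁻¹ ^ N := by
    intro i hi
    have hle : (i : ℕ∞ω) ≤ ∞ := by exact_mod_cast le_top
    -- The composition estimate wants the `l`-th derivative of the inner map bounded by `D ^ l`.
    -- With `D = C₂ * δ⁻¹` this holds because both factors are at least `1`.
    have := norm_iteratedFDeriv_comp_le (g := η) (f := fun y => δ⁻¹ • q y) hη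
      (contDiff_const.smul hq) hle y (C := C₁) (D := C₂ * δ⁻¹)
      (fun l hl => hC₁ l (hl.trans hi) _) (fun l hl hl' => by
        have hql : ContDiffAt ℝ l q y := (hq.of_le (by exact_mod_cast le_top)).contDiffAt
        rw [iteratedFDeriv_const_smul_apply' hql, norm_smul, Real.norm_of_nonneg (by positivity),
          mul_pow, mul_comm]
        exact mul_le_mul ((hC₂ l (hl'.trans hi) y).trans (le_self_pow₀ h₂ (by omega)))
          (le_self_pow₀ hδ' (by omega)) (by positivity) (by positivity))
    refine this.trans ?_
    rw [mul_pow, ← mul_assoc]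
    exact mul_le_mul_of_nonneg_left (pow_le_pow_right₀ hδ' hi) (by positivity)
  have hle : (j : ℕ∞ω) ≤ ∞ := by exact_mod_cast le_top
  refine (norm_iteratedFDeriv_smul_le (hη.comp (contDiff_const.smul hq)) hb y hle).trans ?_
  rw [Finset.sum_mul]
  refine le_trans ?_ (Finset.single_le_sum (f := fun j => (∑ i ∈ Finset.range (j + 1),
    (j.choose i : ℝ) * (i.factorial * C₁ * C₂ ^ i) * C₃) * δ⁻¹ ^ N)
    (fun i _ => by positivity) (Finset.mem_range.mpr (by omega : j < N + 1)))
  rw [Finset.sum_mul]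
  refine Finset.sum_le_sum fun i hi => ?_
  have hi' : i ≤ N := by have := Finset.mem_range.mp hi; omega
  calc _ ≤ (j.choose i : ℝ) * (i.factorial * C₁ * C₂ ^ i * δ⁻¹ ^ N) * C₃ := by
        refine mul_le_mul (mul_le_mul_of_nonneg_left (hcomp i hi') (by positivity))
          (hC₃ _ (by omega) y) (norm_nonneg _) (by positivity)
    _ = _ := by ring

end SmoothExtension

/-! ### Volume of tubes around a coordinate subspace -/

section Tube

/-- The projection of `ℝⁿ` to the first `m` coordinates. -/
def firstCoords {m n : ℕ} (h : m ≤ n) : EuclideanSpace ℝ (Fin n) →L[ℝ] (Fin m → ℝ) :=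
  ContinuousLinearMap.pi fun i => EuclideanSpace.proj (Fin.castLE h i)

/-- The set lies in a box with `m` sides of length `2δ` and `n - m` sides of length `2R`. -/
theorem volume_ball_inter_firstCoords_le {m n : ℕ} (h : m ≤ n) (R : ℝ) :
    ∃ C : ENNReal, C ≠ ⊤ ∧ ∀ δ : ℝ, 0 ≤ δ →
      volume {y : EuclideanSpace ℝ (Fin n) | ‖y‖ ≤ R ∧ ‖firstCoords h y‖ ≤ δ} ≤
        C * ENNReal.ofReal δ ^ m := by
  refine ⟨2 ^ m * ENNReal.ofReal (2 * R) ^ (n - m),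
    ENNReal.mul_ne_top (ENNReal.pow_ne_top (by simp)) (ENNReal.pow_ne_top ENNReal.ofReal_ne_top),
    fun δ hδ => ?_⟩
  let r : Fin n → ℝ := fun i => if (i : ℕ) < m then δ else R
  have hsub : {y : EuclideanSpace ℝ (Fin n) | ‖y‖ ≤ R ∧ ‖firstCoords h y‖ ≤ δ} ⊆
      (WithLp.ofLp : EuclideanSpace ℝ (Fin n) → _) ⁻¹' (Set.univ.pi fun i => Icc (-r i) (r i)) := by
    rintro y ⟨hy, hy'⟩ i -
    rw [mem_Icc, ← abs_le]
    by_cases hi : (i : ℕ) < m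
    · simp only [r, hi, if_true]
      exact (norm_le_pi_norm (firstCoords h y) ⟨i, hi⟩).trans hy'
    · simp only [r, hi, if_false]
      exact (PiLp.norm_apply_le y i).trans hy
  refine (measure_mono hsub).trans ?_
  rw [(PiLp.volume_preserving_ofLp (Fin n)).measure_preimage
    (MeasurableSet.univ_pi fun i => measurableSet_Icc).nullMeasurableSet, volume_pi_pi]
  have : ∀ i : Fin n, volume (Icc (-r i) (r i)) =
      if (i : ℕ) < m then ENNReal.ofReal (2 * δ) else ENNReal.ofReal (2 * R) := by
    intro i
    rw [Real.volume_Icc]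
    by_cases hi : (i : ℕ) < m <;> simp only [r, hi, if_true, if_false] <;> congr 1 <;> ring
  simp_rw [this]
  rw [Fin.prod_univ_eq_prod_range (fun i => if i < m then ENNReal.ofReal (2 * δ) else
    ENNReal.ofReal (2 * R)) n, ← Finset.prod_range_mul_prod_Ico _ h,
    Finset.prod_congr rfl (g := fun _ => ENNReal.ofReal (2 * δ))
      (fun i hi => if_pos (Finset.mem_range.mp hi)),
    Finset.prod_congr (s₁ := Finset.Ico m n) rfl (g := fun _ => ENNReal.ofReal (2 * R))
      (fun i hi => if_neg (not_lt.mpr (Finset.mem_Ico.mp hi).1))]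
  simp only [Finset.prod_const, Finset.card_range, Nat.card_Ico]
  rw [ENNReal.ofReal_mul (by norm_num : (0:ℝ) ≤ 2), mul_pow, ENNReal.ofReal_ofNat]
  exact le_of_eq (by ring)

end Tube

/-! ### Smooth densities in charts -/

section Density

variable {n : ℕ} {M : Type*} [TopologicalSpace M] [ChartedSpace (EuclideanSpace ℝ (Fin n)) M]
  [MeasurableSpace M] [BorelSpace M] {vol : Measure M}

omit [ChartedSpace (EuclideanSpace ℝ (Fin n)) M] in
theorem OpenPartialHomeomorph.measurableSet_target_inter_symm_preimage
    (e : OpenPartialHomeomorph M (EuclideanSpace ℝ (Fin n))) {A : Set M} (hA : MeasurableSet A) :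
    MeasurableSet (e.target ∩ e.symm ⁻¹' A) := by
  have h := (continuousOn_iff_continuous_domRestrict.mp e.continuousOn_symm).measurable hA
  have := e.open_target.measurableSet.subtype_image h
  rwa [show Subtype.val '' (e.target.domRestrict e.symm ⁻¹' A) = e.target ∩ e.symm ⁻¹' A by
    ext y; simp [and_comm]] at this

omit [ChartedSpace (EuclideanSpace ℝ (Fin n)) M] in
theorem measure_eq_lintegral_of_map_eq {e : OpenPartialHomeomorph M (EuclideanSpace ℝ (Fin n))}
    {ρ : EuclideanSpace ℝ (Fin n) → ℝ}
    (h : (vol.restrict e.source).map e =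
      (volume.restrict e.target).withDensity (fun y => ENNReal.ofReal (ρ y)))
    {A : Set M} (hA : MeasurableSet A) (hAe : A ⊆ e.source) :
    vol A = ∫⁻ y in e.target ∩ e.symm ⁻¹' A, ENNReal.ofReal (ρ y) := by
  have hB := e.measurableSet_target_inter_symm_preimage hA
  have hm : AEMeasurable e (vol.restrict e.source) :=
    e.continuousOn.aemeasurable e.open_source.measurableSet
  have h1 := congrArg (fun μ => μ (e.target ∩ e.symm ⁻¹' A)) h
  rw [Measure.map_apply_of_aemeasurable hm hB, withDensity_apply _ hB,
    Measure.restrict_restrict hB, inter_right_comm, inter_self,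
    Measure.restrict_apply' e.open_source.measurableSet] at h1
  rw [← h1]
  congr 1
  ext x
  constructor
  · intro hx
    exact ⟨⟨e.map_source (hAe hx), by simpa [e.left_inv (hAe hx)] using hx⟩, hAe hx⟩
  · rintro ⟨⟨-, hx⟩, hxs⟩
    simpa [e.left_inv hxs] using hx

/-- The density function and its reciprocal are both continuous, hence bounded, on the compact image
of `K`. The two-sided form allows volumes in two different charts to be compared through `vol`. -/
theorem IsSmoothPositiveDensity.exists_measure_comparison (hvol : IsSmoothPositiveDensity n vol)
    {e : OpenPartialHomeomorph M (EuclideanSpace ℝ (Fin n))}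
    (he : e ∈ IsManifold.maximalAtlas (𝓡 n) ∞ M) {K : Set M} (hK : IsCompact K)
    (hKe : K ⊆ e.source) :
    ∃ C : ENNReal, C ≠ ⊤ ∧ ∀ A ⊆ K, MeasurableSet A →
      vol A ≤ C * volume (e.target ∩ e.symm ⁻¹' A) ∧
        volume (e.target ∩ e.symm ⁻¹' A) ≤ C * vol A := by
  obtain ⟨ρ, hρ, hρ0, hmap⟩ := hvol e he
  have hK' : IsCompact (e '' K) := hK.image_of_continuousOn (e.continuousOn.mono hKe)
  have hKt : e '' K ⊆ e.target := by rintro _ ⟨x, hx, rfl⟩; exact e.map_source (hKe hx)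
  have hc : ContinuousOn ρ (e '' K) := hρ.continuousOn.mono hKt
  have hci : ContinuousOn (fun y => (ρ y)⁻¹) (e '' K) :=
    hc.inv₀ fun y hy => (hρ0 y (hKt hy)).ne'
  obtain ⟨C₁, hC₁⟩ := (hK'.bddAbove_image hc)
  obtain ⟨C₂, hC₂⟩ := (hK'.bddAbove_image hci)
  refine ⟨max (ENNReal.ofReal C₁) (ENNReal.ofReal C₂), by simp, fun A hAK hA => ?_⟩
  have hB := e.measurableSet_target_inter_symm_preimage hA
  have hBK : ∀ y ∈ e.target ∩ e.symm ⁻¹' A, y ∈ e '' K := fun y hy =>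
    ⟨e.symm y, hAK hy.2, e.right_inv hy.1⟩
  rw [measure_eq_lintegral_of_map_eq hmap hA (hAK.trans hKe)]
  constructor
  · refine (setLIntegral_mono' (g := fun _ => ENNReal.ofReal C₁) hB fun y hy =>
      ENNReal.ofReal_le_ofReal (hC₁ (mem_image_of_mem _ (hBK y hy)))).trans ?_
    rw [setLIntegral_const]
    gcongr
    exact le_max_left _ _
  · calc volume (e.target ∩ e.symm ⁻¹' A) = ∫⁻ y in e.target ∩ e.symm ⁻¹' A, 1 := by simp
      _ ≤ ∫⁻ y in e.target ∩ e.symm ⁻¹' A, ENNReal.ofReal C₂ * ENNReal.ofReal (ρ y) := by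
        refine setLIntegral_mono' hB fun y hy => ?_
        have h1 : (ρ y)⁻¹ ≤ C₂ := hC₂ (mem_image_of_mem _ (hBK y hy))
        have h2 := hρ0 y hy.1
        rw [← ENNReal.ofReal_mul (by linarith [inv_pos.mpr h2]), ← ENNReal.ofReal_one]
        refine ENNReal.ofReal_le_ofReal ?_
        rwa [inv_le_iff_one_le_mul₀ h2] at h1
      _ = ENNReal.ofReal C₂ * ∫⁻ y in e.target ∩ e.symm ⁻¹' A, ENNReal.ofReal (ρ y) :=
        lintegral_const_mul' _ _ ENNReal.ofReal_ne_top
      _ ≤ _ := by gcongr; exact le_max_right _ _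

theorem IsSmoothPositiveDensity.isLocallyFiniteMeasure [T2Space M]
    (hvol : IsSmoothPositiveDensity n vol) [IsManifold (𝓡 n) ∞ M] :
    IsLocallyFiniteMeasure vol := by
  have : LocallyCompactSpace M := ChartedSpace.locallyCompactSpace (EuclideanSpace ℝ (Fin n)) M
  refine ⟨fun p => ?_⟩
  let e := chartAt (EuclideanSpace ℝ (Fin n)) p
  obtain ⟨K, hKp, hKe, hK⟩ := local_compact_nhds (e.open_source.mem_nhds (mem_chart_source _ p))
  obtain ⟨C, hC, h⟩ := hvol.exists_measure_comparison (IsManifold.chart_mem_maximalAtlas p) hK hKe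
  refine ⟨K, hKp, ((h K subset_rfl hK.isClosed.measurableSet).1).trans_lt
    (ENNReal.mul_lt_top hC.lt_top ?_)⟩
  refine (measure_mono (t := e '' K) fun y hy => ⟨e.symm y, hy.2, e.right_inv hy.1⟩).trans_lt ?_
  exact (hK.image_of_continuousOn (e.continuousOn.mono hKe)).measure_lt_top

theorem IsSmoothPositiveDensity.isOpenPosMeasure
    (hvol : IsSmoothPositiveDensity n vol) [IsManifold (𝓡 n) ∞ M] :
    vol.IsOpenPosMeasure := by
  refine ⟨fun U hU ⟨p, hp⟩ h0 => ?_⟩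
  let e := chartAt (EuclideanSpace ℝ (Fin n)) p
  have : LocallyCompactSpace M := ChartedSpace.locallyCompactSpace (EuclideanSpace ℝ (Fin n)) M
  obtain ⟨K, hKp, hKe, hK⟩ := local_compact_nhds (Filter.inter_mem (hU.mem_nhds hp)
    (e.open_source.mem_nhds (mem_chart_source _ p)))
  obtain ⟨C, hC, h⟩ := hvol.exists_measure_comparison (IsManifold.chart_mem_maximalAtlas p) hK
    (hKe.trans inter_subset_right)
  have h1 := (h (interior K) interior_subset isOpen_interior.measurableSet).2
  rw [measure_mono_null (interior_subset.trans (hKe.trans inter_subset_left)) h0, mul_zero,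
    nonpos_iff_eq_zero] at h1
  have hopen : IsOpen (e.target ∩ e.symm ⁻¹' interior K) :=
    e.isOpen_inter_preimage_symm isOpen_interior
  refine (hopen.measure_pos volume ⟨e p, e.map_source (mem_chart_source _ p), ?_⟩).ne' h1
  rw [mem_preimage, e.left_inv (mem_chart_source _ p)]
  exact mem_interior_iff_mem_nhds.mpr hKp

theorem IsSmoothPositiveDensity.exists_measure_tube_le [T2Space M]
    (hvol : IsSmoothPositiveDensity n vol)
    {e : OpenPartialHomeomorph M (EuclideanSpace ℝ (Fin n))}
    (he : e ∈ IsManifold.maximalAtlas (𝓡 n) ∞ M) {K : Set M} (hK : IsCompact K)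
    (hKe : K ⊆ e.source) {m : ℕ} (hm : m ≤ n) :
    ∃ C : ENNReal, C ≠ ⊤ ∧ ∀ δ : ℝ, 0 ≤ δ →
      MeasurableSet (K ∩ {x | ‖firstCoords hm (e x)‖ ≤ δ}) ∧
      vol (K ∩ {x | ‖firstCoords hm (e x)‖ ≤ δ}) ≤ C * ENNReal.ofReal δ ^ m := by
  obtain ⟨C₁, hC₁, h₁⟩ := hvol.exists_measure_comparison he hK hKe
  obtain ⟨R, hR⟩ := (hK.image_of_continuousOn (e.continuousOn.mono hKe)).isBounded.exists_norm_le
  obtain ⟨C₂, hC₂, h₂⟩ := volume_ball_inter_firstCoords_le hm R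
  refine ⟨C₁ * C₂, ENNReal.mul_ne_top hC₁ hC₂, fun δ hδ => ?_⟩
  have hcl : IsClosed (K ∩ {x | ‖firstCoords hm (e x)‖ ≤ δ}) := by
    refine ContinuousOn.preimage_isClosed_of_isClosed (f := fun x => ‖firstCoords hm (e x)‖)
      (t := Iic δ) ?_ hK.isClosed isClosed_Iic
    exact ((firstCoords hm).continuous.comp_continuousOn (e.continuousOn.mono hKe)).norm
  refine ⟨hcl.measurableSet, ((h₁ _ inter_subset_left hcl.measurableSet).1).trans ?_⟩
  rw [mul_assoc]
  gcongr
  refine (measure_mono ?_).trans (h₂ δ hδ)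
  rintro y ⟨hy, hyK, hyδ⟩
  refine ⟨hR y ⟨_, hyK, e.right_inv hy⟩, ?_⟩
  simpa [e.right_inv hy] using hyδ

theorem firstCoords_eq_zero_iff {m n : ℕ} (h : m ≤ n) (y : EuclideanSpace ℝ (Fin n)) :
    firstCoords h y = 0 ↔ ∀ i : Fin n, (i : ℕ) < m → y i = 0 :=
  ⟨fun hy i hi => congrFun hy ⟨i, hi⟩, fun hy => funext fun i => hy (Fin.castLE h i) i.2⟩

theorem IsSmoothPositiveDensity.measure_submanifold_eq_zero [T2Space M] [SecondCountableTopology M]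
    (hvol : IsSmoothPositiveDensity n vol) {S : Set M} {m : ℕ}
    (hS : IsEmbeddedSubmanifoldOfCodim n S m) (hm : m ≠ 0) : vol S = 0 := by
  have : LocallyCompactSpace M := ChartedSpace.locallyCompactSpace (EuclideanSpace ℝ (Fin n)) M
  refine measure_null_of_locally_null S fun p hp => ?_
  obtain ⟨e, he, hpe, heS⟩ := hS.2 p hp
  obtain ⟨K, hKp, hKe, hK⟩ := local_compact_nhds (e.open_source.mem_nhds hpe)
  obtain ⟨C, hC, h⟩ := hvol.exists_measure_tube_le he hK hKe hS.1
  -- Near `p` the submanifold lies in the tube of radius `0`, whose measure is at most `C * 0 ^ m =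
  -- 0`.
  have h0 := (h 0 le_rfl).2
  rw [ENNReal.ofReal_zero, zero_pow hm, mul_zero, nonpos_iff_eq_zero] at h0
  refine ⟨S ∩ K, inter_mem_nhdsWithin S hKp, ?_⟩
  have hsub : S ∩ K ⊆ K ∩ {x | ‖firstCoords hS.1 (e x)‖ ≤ 0} := fun x hx => by
    refine ⟨hx.2, ?_⟩
    rw [mem_ofPred_eq, (firstCoords_eq_zero_iff hS.1 _).mpr ((heS x (hKe hx.2)).mp hx.1), norm_zero]
  exact measure_mono_null hsub h0

omit [ChartedSpace (EuclideanSpace ℝ (Fin n)) M] in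
theorem integral_eq_integral_chart {e : OpenPartialHomeomorph M (EuclideanSpace ℝ (Fin n))}
    {ρ : EuclideanSpace ℝ (Fin n) → ℝ} (hρ : ContinuousOn ρ e.target)
    (hρ0 : ∀ y ∈ e.target, 0 < ρ y)
    (h : (vol.restrict e.source).map e =
      (volume.restrict e.target).withDensity (fun y => ENNReal.ofReal (ρ y)))
    {g : M → ℝ} (hg : ContinuousOn g e.source) (hg0 : ∀ x ∉ e.source, g x = 0) :
    ∫ x, g x ∂vol = ∫ y in e.target, ρ y * g (e.symm y) := by
  have hm : AEMeasurable e (vol.restrict e.source) :=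
    e.continuousOn.aemeasurable e.open_source.measurableSet
  have ht := e.open_target.measurableSet
  have hgc : ContinuousOn (fun y => g (e.symm y)) e.target :=
    hg.comp e.continuousOn_symm e.symm.mapsTo
  have hρm : AEMeasurable (fun y => ENNReal.ofReal (ρ y)) (volume.restrict e.target) :=
    (hρ.aemeasurable ht).ennreal_ofReal
  calc ∫ x, g x ∂vol = ∫ x in e.source, g x ∂vol :=
      (setIntegral_eq_integral_of_forall_compl_eq_zero hg0).symm
    _ = ∫ x in e.source, g (e.symm (e x)) ∂vol :=
      setIntegral_congr_fun e.open_source.measurableSet fun x hx => by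
        simp only [e.left_inv hx]
    _ = ∫ y, g (e.symm y) ∂((vol.restrict e.source).map e) := by
      rw [integral_map hm]
      rw [h]
      exact ((hgc.aestronglyMeasurable ht).mono_ac (withDensity_absolutelyContinuous _ _))
    _ = ∫ y in e.target, (ENNReal.ofReal (ρ y)).toReal • g (e.symm y) := by
      rw [h, integral_withDensity_eq_integral_toReal_smul₀ hρm (by simp)]
    _ = _ := setIntegral_congr_fun ht fun y hy => by
      simp only [ENNReal.toReal_ofReal (hρ0 y hy).le, smul_eq_mul]

end Density

/-! ### Sections in trivializations, and the distribution defined by `u` -/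

section Sections

variable {n : ℕ} {M : Type*} [TopologicalSpace M] [ChartedSpace (EuclideanSpace ℝ (Fin n)) M]

theorem IsCompact.exists_forall_le_of_eventually {K S : Set M} (hK : IsCompact K) {g : M → ℝ}
    (h : ∀ p ∈ K, ∃ C : ℝ, ∀ᶠ x in 𝓝 p, x ∉ S → g x ≤ C) :
    ∃ C : ℝ, 0 ≤ C ∧ ∀ x ∈ K, x ∉ S → g x ≤ C := by
  refine hK.induction_on (p := fun K => ∃ C : ℝ, 0 ≤ C ∧ ∀ x ∈ K, x ∉ S → g x ≤ C)
    ⟨0, le_rfl, by simp⟩ (fun s t hst ⟨C, hC, ht⟩ => ⟨C, hC, fun x hx => ht x (hst hx)⟩) ?_ ?_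
  · rintro s t ⟨C, hC, hs⟩ ⟨D, hD, ht⟩
    refine ⟨max C D, le_max_of_le_left hC, ?_⟩
    rintro x (hx | hx) hxS
    · exact (hs x hx hxS).trans (le_max_left _ _)
    · exact (ht x hx hxS).trans (le_max_right _ _)
  · intro p hp
    obtain ⟨C, hC⟩ := h p hp
    exact ⟨_, mem_nhdsWithin_of_mem_nhds hC, max C 0, le_max_right _ _,
      fun x hx hxS => (hx hxS).trans (le_max_left _ _)⟩

variable {V : Type*} [NormedAddCommGroup V] [NormedSpace ℝ V]
  {E : M → Type*} [TopologicalSpace (TotalSpace V E)] [∀ x, AddCommGroup (E x)]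
  [∀ x, Module ℝ (E x)] [∀ x, TopologicalSpace (E x)] [FiberBundle V E] [VectorBundle ℝ V E]

variable (V) in
/-- The section `s` in the preferred trivialization at `x₀`, as a function on the base. -/
def trivRep (s : ∀ x, E x) (x₀ x : M) : V :=
  (trivializationAt V E x₀ (TotalSpace.mk' V x (s x))).2

-- The trivialization of the dual bundle is conjugation by that of `E`, so the two trivialization
-- maps cancel in the pairing.
omit [ChartedSpace (EuclideanSpace ℝ (Fin n)) M] in
theorem pairing_eq_trivRep (φ : ∀ x, E x →L[ℝ] Bundle.Trivial M ℝ x) (s : ∀ x, E x) {x₀ x : M}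
    (hx : x ∈ (trivializationAt V E x₀).baseSet) :
    (φ x (s x) : ℝ) = trivRep (V →L[ℝ] ℝ) φ x₀ x (trivRep V s x₀ x) := by
  simp only [trivRep]
  rw [TotalSpace.mk', hom_trivializationAt_apply]
  simp only [ContinuousLinearMap.inCoordinates, ContinuousLinearMap.coe_comp, Function.comp]
  rw [Trivialization.symmL_apply _ hx, TotalSpace.mk', Trivialization.symm_apply_apply_mk _ hx]
  rw [Trivialization.continuousLinearMapAt_apply, Trivialization.linearMapAt_apply, if_pos (by trivial)]
  rfl

omit [ChartedSpace (EuclideanSpace ℝ (Fin n)) M] in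
theorem trivRep_smul (c : ℝ) (s : ∀ x, E x) {x₀ x : M}
    (hx : x ∈ (trivializationAt V E x₀).baseSet) {t : ∀ x, E x} (h : t x = c • s x) :
    trivRep V t x₀ x = c • trivRep V s x₀ x := by
  simp only [trivRep, TotalSpace.mk', h]
  exact ((trivializationAt V E x₀).linear ℝ hx).map_smul c (s x)

omit [ChartedSpace (EuclideanSpace ℝ (Fin n)) M] in
theorem eq_zero_of_trivRep_eq_zero (s : ∀ x, E x) {x₀ x : M}
    (hx : x ∈ (trivializationAt V E x₀).baseSet) (h : trivRep V s x₀ x = 0) : s x = 0 := by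
  have h1 := (trivializationAt V E x₀).symm_apply_apply_mk hx (s x)
  rw [← h1]
  change (trivializationAt V E x₀).symm x (trivRep V s x₀ x) = 0
  rw [h, ← Trivialization.symmL_apply (R := ℝ) _ hx]
  exact map_zero _

theorem localRep_chart (s : ∀ x, E x) (x₀ : M) {x : M}
    (hx : x ∈ (chartAt (EuclideanSpace ℝ (Fin n)) x₀).source) :
    localRep n V s x₀ (chartAt (EuclideanSpace ℝ (Fin n)) x₀ x) = trivRep V s x₀ x := by
  simp only [localRep, trivRep]
  rw [(chartAt (EuclideanSpace ℝ (Fin n)) x₀).left_inv hx]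

theorem IsSmoothSectionOn.contMDiffOn_trivRep [ContMDiffVectorBundle ∞ V E (𝓡 n)]
    [IsManifold (𝓡 n) ∞ M] {s : ∀ x, E x}
    {A : Set M} (hs : IsSmoothSectionOn n V s A) (hA : IsOpen A) (x₀ : M) :
    ContMDiffOn (𝓡 n) 𝓘(ℝ, V) ∞ (trivRep V s x₀) (A ∩ (trivializationAt V E x₀).baseSet) :=
  ((trivializationAt V E x₀).contMDiffOn_section_iff
    (hA.inter (trivializationAt V E x₀).open_baseSet) inter_subset_right).mp
    (hs.mono inter_subset_left)

theorem IsSmoothSectionOn.contDiffOn_localRep [ContMDiffVectorBundle ∞ V E (𝓡 n)]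
    [IsManifold (𝓡 n) ∞ M] {s : ∀ x, E x}
    {A : Set M} (hs : IsSmoothSectionOn n V s A) (hA : IsOpen A) (x₀ : M) :
    ContDiffOn ℝ ∞ (localRep n V s x₀) ((chartAt (EuclideanSpace ℝ (Fin n)) x₀).target ∩
      (chartAt (EuclideanSpace ℝ (Fin n)) x₀).symm ⁻¹' (A ∩ (trivializationAt V E x₀).baseSet)) := by
  rw [← contMDiffOn_iff_contDiffOn]
  exact (hs.contMDiffOn_trivRep hA x₀).comp
    ((contMDiffOn_chart_symm (I := 𝓡 n) (n := ∞) (x := x₀)).mono inter_subset_left)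
    fun y hy => hy.2

theorem IsSmoothSectionOn.contMDiffOn_pairing {φ : ∀ x, E x →L[ℝ] Bundle.Trivial M ℝ x}
    {s : ∀ x, E x} {A : Set M} (hφ : IsSmoothSectionOn n (V →L[ℝ] ℝ) φ A)
    (hs : IsSmoothSectionOn n V s A) :
    ContMDiffOn (𝓡 n) 𝓘(ℝ, ℝ) ∞ (fun x => (φ x (s x) : ℝ)) A := fun x hx =>
  (contMDiffWithinAt_section.mp (ContMDiffOn.clm_bundle_apply (b := id) hφ hs x hx))

theorem DualSection.isSmoothSectionOn (φ : DualSection n V E) (A : Set M) :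
    IsSmoothSectionOn n (V →L[ℝ] ℝ) φ A := φ.contMDiff.contMDiffOn

theorem ContMDiffSection.isSmoothSectionOn (s : Cₛ^∞⟮𝓡 n; V, E⟯) (A : Set M) :
    IsSmoothSectionOn n V s A := s.contMDiff.contMDiffOn

theorem DualSection.contMDiff_pairing (φ : DualSection n V E) (s : Cₛ^∞⟮𝓡 n; V, E⟯) :
    ContMDiff (𝓡 n) 𝓘(ℝ, ℝ) ∞ fun x => (φ x (s x) : ℝ) :=
  contMDiffOn_univ.mp ((φ.isSmoothSectionOn univ).contMDiffOn_pairing (s.isSmoothSectionOn univ))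

theorem IsLocallyBoundedNear.eventually_norm_trivRep_le [ContMDiffVectorBundle ∞ V E (𝓡 n)]
    [IsManifold (𝓡 n) ∞ M] {S : Set M} (hS : IsClosed S)
    {u : ∀ x, E x} (hu : IsSmoothSectionOn n V u Sᶜ) (hb : IsLocallyBoundedNear V u S) (p : M) :
    ∃ C : ℝ, ∀ᶠ x in 𝓝 p, x ∉ S → ‖trivRep V u p x‖ ≤ C := by
  by_cases hp : p ∈ S
  · exact hb p hp
  · have hO := hS.isOpen_compl.inter (trivializationAt V E p).open_baseSet
    have hc : ContinuousAt (trivRep V u p) p :=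
      (hu.contMDiffOn_trivRep hS.isOpen_compl p).continuousOn.continuousAt
        (hO.mem_nhds ⟨hp, mem_baseSet_trivializationAt V E p⟩)
    refine ⟨‖trivRep V u p p‖ + 1, ?_⟩
    filter_upwards [hc.norm.eventually (gt_mem_nhds (lt_add_one _))] with x hx _ using hx.le

/-- Boundedness is given in the trivialization at each point of `S`. The coordinate change to the
one at `x₀` is continuous, hence locally bounded in norm, and compactness of `K` makes the bound
uniform. -/
theorem IsLocallyBoundedNear.exists_norm_trivRep_le [ContMDiffVectorBundle ∞ V E (𝓡 n)]
    [IsManifold (𝓡 n) ∞ M] {S : Set M} (hS : IsClosed S)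
    {u : ∀ x, E x} (hu : IsSmoothSectionOn n V u Sᶜ) (hb : IsLocallyBoundedNear V u S) {x₀ : M}
    {K : Set M} (hK : IsCompact K) (hK₀ : K ⊆ (trivializationAt V E x₀).baseSet) :
    ∃ C : ℝ, 0 ≤ C ∧ ∀ x ∈ K, x ∉ S → ‖trivRep V u x₀ x‖ ≤ C := by
  refine hK.exists_forall_le_of_eventually fun p hp => ?_
  obtain ⟨C, hC⟩ := hb.eventually_norm_trivRep_le hS hu p
  set e := trivializationAt V E p
  set e₀ := trivializationAt V E x₀
  have hmem : e.baseSet ∩ e₀.baseSet ∈ 𝓝 p := (e.open_baseSet.inter e₀.open_baseSet).mem_nhds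
    ⟨mem_baseSet_trivializationAt V E p, hK₀ hp⟩
  have hcc : ContinuousAt (fun x => ‖(e.coordChangeL ℝ e₀ x : V →L[ℝ] V)‖) p :=
    ((continuousOn_coordChange ℝ e e₀).continuousAt hmem).norm
  refine ⟨(‖(e.coordChangeL ℝ e₀ p : V →L[ℝ] V)‖ + 1) * C, ?_⟩
  filter_upwards [hC, hcc.eventually (gt_mem_nhds (lt_add_one _)), hmem] with x hx hx' hxm hxS
  have : trivRep V u x₀ x = e.coordChangeL ℝ e₀ x (trivRep V u p x) := by
    rw [e.coordChangeL_apply e₀ hxm]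
    change _ = (e₀ ⟨x, e.symm x (e ⟨x, u x⟩).2⟩).2
    rw [e.symm_apply_apply_mk hxm.1]
    rfl
  rw [this]
  exact ((e.coordChangeL ℝ e₀ x : V →L[ℝ] V).le_opNorm _).trans
    (mul_le_mul hx'.le (hx hxS) (norm_nonneg _) (by positivity))

theorem IsLocallyBoundedNear.exists_abs_pairing_le [ContMDiffVectorBundle ∞ V E (𝓡 n)]
    [IsManifold (𝓡 n) ∞ M] {S : Set M} (hS : IsClosed S)
    {u : ∀ x, E x} (hu : IsSmoothSectionOn n V u Sᶜ) (hb : IsLocallyBoundedNear V u S)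
    (φ : DualSection n V E) {K : Set M} (hK : IsCompact K) :
    ∃ C : ℝ, 0 ≤ C ∧ ∀ x ∈ K, x ∉ S → ‖(φ x (u x) : ℝ)‖ ≤ C := by
  refine hK.exists_forall_le_of_eventually fun p hp => ?_
  obtain ⟨C, hC⟩ := hb.eventually_norm_trivRep_le hS hu p
  have hc : ContinuousAt (trivRep (V →L[ℝ] ℝ) φ p) p :=
    ((φ.isSmoothSectionOn univ).contMDiffOn_trivRep isOpen_univ p).continuousOn.continuousAt
      ((isOpen_univ.inter (Trivialization.open_baseSet _)).mem_nhds
        ⟨mem_univ _, mem_baseSet_trivializationAt (V →L[ℝ] ℝ) _ p⟩)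
  refine ⟨(‖trivRep (V →L[ℝ] ℝ) φ p p‖ + 1) * C, ?_⟩
  filter_upwards [hC, hc.norm.eventually (gt_mem_nhds (lt_add_one _)),
    (trivializationAt V E p).open_baseSet.mem_nhds (mem_baseSet_trivializationAt V E p)]
    with x hx hx' hxm hxS
  rw [pairing_eq_trivRep φ u hxm]
  exact ((trivRep (V →L[ℝ] ℝ) φ p x).le_opNorm _).trans
    (mul_le_mul hx'.le (hx hxS) (norm_nonneg _) (by positivity))

section Integration

variable [ContMDiffVectorBundle ∞ V E (𝓡 n)] [IsManifold (𝓡 n) ∞ M] [T2Space M]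
  [SecondCountableTopology M] [MeasurableSpace M] [BorelSpace M]

theorem IsLocallyBoundedNear.integrable_pairing {vol : Measure M} [IsLocallyFiniteMeasure vol]
    {S : Set M} (hS : IsClosed S) (hS0 : vol S = 0)
    {u : ∀ x, E x} (hu : IsSmoothSectionOn n V u Sᶜ) (hb : IsLocallyBoundedNear V u S)
    (φ : DualSection n V E) {K : Set M} (hK : IsCompact K) (hφ : ∀ x ∉ K, φ x = 0) :
    Integrable (fun x => (φ x (u x) : ℝ)) vol := by
  obtain ⟨C, -, hC⟩ := hb.exists_abs_pairing_le hS hu φ hK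
  have hae : ∀ᵐ x ∂vol, x ∈ Sᶜ := measure_eq_zero_iff_ae_notMem.mp hS0
  have hmeas : AEStronglyMeasurable (fun x => (φ x (u x) : ℝ)) vol := by
    rw [← Measure.restrict_eq_self_of_ae_mem hae]
    exact ((φ.isSmoothSectionOn Sᶜ).contMDiffOn_pairing hu).continuousOn.aestronglyMeasurable
      hS.isOpen_compl.measurableSet
  rw [← integrableOn_iff_integrable_of_support_subset (s := K)]
  · refine Measure.integrableOn_of_bounded (M := C) hK.measure_lt_top.ne hmeas ?_
    filter_upwards [ae_restrict_mem hK.isClosed.measurableSet, ae_restrict_of_ae hae] with x hx hxS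
    exact hC x hx hxS
  · intro x hx
    by_contra h
    exact hx (by simp [hφ x h])

/-- The distributional section on `M` given by integration against a section which is smooth off a
closed null set `S` and locally bounded near `S`. -/
def distributionOfLocallyBounded (vol : Measure M) [IsLocallyFiniteMeasure vol]
    {S : Set M} (hS : IsClosed S) (hS0 : vol S = 0) {u : ∀ x, E x}
    (hu : IsSmoothSectionOn n V u Sᶜ) (hb : IsLocallyBoundedNear V u S) :
    DistributionalSection n V E univ where
  toLinearMap :=
    { toFun := fun φ => ∫ x, (φ.1 x (u x) : ℝ) ∂vol
      map_add' := by
        rintro ⟨φ, K, hK, hKu, hφ⟩ ⟨ψ, K', hK', hKu', hψ⟩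
        exact integral_add (hb.integrable_pairing hS hS0 hu φ hK hφ)
          (hb.integrable_pairing hS hS0 hu ψ hK' hψ)
      map_smul' := fun c φ => integral_const_mul c _ }
  continuous' := by
    intro x₀ K hK _ hK₀
    obtain ⟨C, hC0, hC⟩ := hb.exists_norm_trivRep_le hS hu hK (x₀ := x₀)
      fun x hx => (hK₀ hx).2.1
    have hae : ∀ᵐ x ∂vol, x ∈ Sᶜ := measure_eq_zero_iff_ae_notMem.mp hS0
    -- The distribution has order `0`: no derivatives of the test section are needed.
    refine ⟨C * vol.real K, 0, fun φ hφ B hB hφB => ?_⟩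
    change |∫ x, (φ.1 x (u x) : ℝ) ∂vol| ≤ _
    rw [← setIntegral_eq_integral_of_forall_compl_eq_zero (s := K)
      fun x hx => by rw [hφ x hx]; rfl, ← Real.norm_eq_abs]
    refine (norm_setIntegral_le_of_norm_le_const_ae' (C := B * C) hK.measure_lt_top ?_).trans_eq
      (by ring)
    filter_upwards [hae] with x hxS hx
    rw [pairing_eq_trivRep φ.1 u (hK₀ hx).2.1]
    have h1 := hφB 0 le_rfl x hx
    rw [norm_iteratedFDeriv_zero, localRep_chart _ _ (hK₀ hx).1] at h1
    exact ((trivRep (V →L[ℝ] ℝ) φ.1 x₀ x).le_opNorm _).trans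
      (mul_le_mul h1 (hC x hx hxS) (norm_nonneg _) hB)

end Integration

end Sections

/-! ### The tube estimate in coordinates -/

section TubeEstimate

variable {n : ℕ} {V : Type*} [NormedAddCommGroup V] [NormedSpace ℝ V]

theorem ContDiffOn.smul_dual {H X : Type*} [NormedAddCommGroup H] [NormedSpace ℝ H]
    [NormedAddCommGroup X] [NormedSpace ℝ X] {f : H → ℝ} {g : H → X →L[ℝ] ℝ} {s : Set H}
    (hf : ContDiffOn ℝ ∞ f s) (hg : ContDiffOn ℝ ∞ g s) : ContDiffOn ℝ ∞ (fun y => f y • g y) s :=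
  hf.smul hg

/-- The integrand vanishes where `‖q‖ ≥ δ / 2`, so multiplying the coefficients by a cutoff of scale
`δ` changes nothing while confining them to the `δ`-tube. Integration by parts then puts at most `k`
derivatives on the new coefficients, costing `δ⁻¹ ^ k`. `C` depends on `w` only through its bound
`A`. -/
theorem exists_abs_integral_diffOp_le_of_tube {G : Type*} [NormedAddCommGroup G] [NormedSpace ℝ G]
    [FiniteDimensional ℝ G] (k : ℕ) {O Z : Set (EuclideanSpace ℝ (Fin n))} (hO : IsOpen O)
    (hZ : IsCompact Z) (hZO : Z ⊆ O)
    (b : ∀ j : ℕ, EuclideanSpace ℝ (Fin n) → (EuclideanSpace ℝ (Fin n) [×j]→L[ℝ] V) →L[ℝ] ℝ)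
    (hb : ∀ j, ContDiff ℝ ∞ (b j)) (hbZ : ∀ j, ∀ y ∉ Z, b j y = 0)
    {q : EuclideanSpace ℝ (Fin n) → G} (hq : ContDiffOn ℝ ∞ q O) {A : ℝ} (hA : 0 ≤ A) :
    ∃ C : ℝ, 0 ≤ C ∧ ∀ δ : ℝ, 0 < δ → δ ≤ 1 → ∀ w : EuclideanSpace ℝ (Fin n) → V,
      ContDiffOn ℝ ∞ w O → (∀ y ∈ Z, ‖w y‖ ≤ A) →
      (∀ y ∈ Z, δ / 2 ≤ ‖q y‖ →
        ∑ j ∈ Finset.range (k + 1), b j y (iteratedFDeriv ℝ j w y) = 0) →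
      |∫ y, ∑ j ∈ Finset.range (k + 1), b j y (iteratedFDeriv ℝ j w y)| ≤
        C * δ⁻¹ ^ k * volume.real (Z ∩ {y | ‖q y‖ ≤ δ}) := by
  obtain ⟨q', hq', hq's, hqq⟩ := hq.exists_contDiff_eq_nhdsSet hO hZ hZO
  have hqZ : ∀ y ∈ Z, q' y = q y := fun y hy => hqq.self_of_nhdsSet y hy
  -- After rescaling by `δ`, the inner radius `1 / 2` matches the region where the integrand may be
  -- nonzero and the outer radius `1` matches the tube in the conclusion.
  let η : ContDiffBump (0 : G) := ⟨1 / 2, 1, by norm_num, by norm_num⟩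
  have hη1 : ∀ z : G, ‖z‖ ≤ 1 / 2 → η z = 1 := fun z hz =>
    η.one_of_mem_closedBall (mem_closedBall_zero_iff.mpr hz)
  have hη0 : ∀ z : G, 1 < ‖z‖ → η z = 0 := fun z hz =>
    η.zero_of_le_dist (by simpa using hz.le)
  choose C₁ hC₁ h₁ using fun j => exists_abs_integral_iteratedFDeriv_le (n := n) (V := V) j
  choose C₂ hC₂ h₂ using fun j => exists_norm_iteratedFDeriv_scaled_smul_le
    (η := η) η.contDiff η.hasCompactSupport hq' hq's (hb j) (HasCompactSupport.intro hZ (hbZ j)) k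
  refine ⟨∑ j ∈ Finset.range (k + 1), C₁ j * C₂ j * A,
    Finset.sum_nonneg fun j _ => mul_nonneg (mul_nonneg (hC₁ j) (hC₂ j)) hA,
    fun δ hδ hδ1 w hw hwA hw0 => ?_⟩
  obtain ⟨w', hw', -, hww⟩ := hw.exists_contDiff_eq_nhdsSet hO hZ hZO
  have hD : ∀ j, ∀ y ∈ Z, iteratedFDeriv ℝ j w' y = iteratedFDeriv ℝ j w y := fun j y hy =>
    (Filter.EventuallyEq.iteratedFDeriv ℝ (eventually_nhdsSet_iff_forall.mp hww y hy) j).eq_of_nhds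
  have hnorm : ∀ z : G, ‖δ⁻¹ • z‖ = δ⁻¹ * ‖z‖ := fun z => by
    rw [norm_smul, Real.norm_of_nonneg (by positivity)]
  have hZδ : Z ∩ {y | ‖q y‖ ≤ δ} = Z ∩ {y | ‖q' y‖ ≤ δ} := by
    ext y
    refine and_congr_right fun hy => ?_
    change ‖q y‖ ≤ δ ↔ ‖q' y‖ ≤ δ
    rw [hqZ y hy]
  have hZc : IsCompact (Z ∩ {y | ‖q y‖ ≤ δ}) := by
    rw [hZδ]
    exact hZ.inter_right (isClosed_le hq'.continuous.norm continuous_const)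
  have hbδ : ∀ j, ContDiff ℝ ∞ fun y => η (δ⁻¹ • q' y) • b j y := fun j =>
    contDiffOn_univ.mp ((η.contDiff.comp (contDiff_const.smul hq')).contDiffOn.smul_dual
      (hb j).contDiffOn)
  have hbδ0 : ∀ j, ∀ y ∉ Z ∩ {y | ‖q y‖ ≤ δ}, η (δ⁻¹ • q' y) • b j y = 0 := by
    intro j y hy
    by_cases hyZ : y ∈ Z
    · have : δ < ‖q' y‖ := by
        rw [hqZ y hyZ]
        exact not_le.mp fun h => hy ⟨hyZ, h⟩
      rw [hη0, zero_smul]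
      rw [hnorm, inv_mul_eq_div, one_lt_div hδ]
      exact this
    · rw [hbZ j y hyZ, smul_zero]
  -- On `Z` either the cutoff is `1` or the whole sum is zero; off `Z` every coefficient is zero.
  -- Only the sum vanishes, not its terms, so the cutoff has to be inserted before splitting over
  -- `j`.
  have heq : ∀ y, ∑ j ∈ Finset.range (k + 1), b j y (iteratedFDeriv ℝ j w y) =
      ∑ j ∈ Finset.range (k + 1), (η (δ⁻¹ • q' y) • b j y) (iteratedFDeriv ℝ j w' y) := by
    intro y
    by_cases hyZ : y ∈ Z
    · have hsum : ∑ j ∈ Finset.range (k + 1), (η (δ⁻¹ • q' y) • b j y) (iteratedFDeriv ℝ j w' y) =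
          η (δ⁻¹ • q' y) * ∑ j ∈ Finset.range (k + 1), b j y (iteratedFDeriv ℝ j w y) := by
        rw [Finset.mul_sum]
        exact Finset.sum_congr rfl fun j _ => by rw [hD j y hyZ]; rfl
      rw [hsum]
      rcases le_or_gt (δ / 2) ‖q y‖ with h | h
      · rw [hw0 y hyZ h, mul_zero]
      · rw [hη1, one_mul]
        rw [hnorm, hqZ y hyZ, inv_mul_eq_div, div_le_iff₀ hδ]
        linarith
    · refine Finset.sum_congr rfl fun j _ => ?_
      rw [hbZ j y hyZ, smul_zero]
      rfl
  simp_rw [heq]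
  have hint : ∀ j, Integrable fun y => (η (δ⁻¹ • q' y) • b j y) (iteratedFDeriv ℝ j w' y) :=
    fun j => ((hbδ j).continuous.clm_apply
      (hw'.continuous_iteratedFDeriv (m := j) (by exact_mod_cast le_top))).integrable_of_hasCompactSupport
      (HasCompactSupport.intro hZc fun y hy => by rw [hbδ0 j y hy]; rfl)
  rw [integral_finsetSum _ fun j _ => hint j, Finset.sum_mul, Finset.sum_mul]
  refine (Finset.abs_sum_le_sum_abs _ _).trans (Finset.sum_le_sum fun j hj => ?_)
  refine (h₁ j _ w' _ A (C₂ j * δ⁻¹ ^ k) (hbδ j) hw' hZc (hbδ0 j) (fun y hy => ?_)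
    (h₂ j j (by have := Finset.mem_range.mp hj; omega) δ hδ hδ1)).trans_eq (by ring)
  rw [hww.self_of_nhdsSet y hy.1]
  exact hwA y hy.1

end TubeEstimate

/-! ### The estimate near a point of `S` -/

section LocalEstimate

variable {n : ℕ} {M : Type*} [TopologicalSpace M] [ChartedSpace (EuclideanSpace ℝ (Fin n)) M]
  [IsManifold (𝓡 n) ∞ M] [T2Space M] [SecondCountableTopology M]
  [MeasurableSpace M] [BorelSpace M]
  {V : Type*} [NormedAddCommGroup V] [NormedSpace ℝ V]
  {E : M → Type*} [TopologicalSpace (TotalSpace V E)] [∀ x, AddCommGroup (E x)]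
  [∀ x, Module ℝ (E x)] [∀ x, TopologicalSpace (E x)] [FiberBundle V E] [VectorBundle ℝ V E]
  [ContMDiffVectorBundle ∞ V E (𝓡 n)]
  {W : Type*} [NormedAddCommGroup W] [NormedSpace ℝ W]
  {F : M → Type*} [TopologicalSpace (TotalSpace W F)] [∀ x, AddCommGroup (F x)]
  [∀ x, Module ℝ (F x)] [∀ x, TopologicalSpace (F x)] [FiberBundle W F] [VectorBundle ℝ W F]
  [ContMDiffVectorBundle ∞ W F (𝓡 n)]

/-- The section `v` is obtained from `u` by a cutoff with values in `[0, 1]` vanishing on `S`, and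
`L v = 0` off `N`. -/
structure IsCutoffSolution (L : Cₛ^∞⟮𝓡 n; V, E⟯ →ₗ[ℝ] Cₛ^∞⟮𝓡 n; W, F⟯) (S N : Set M)
    (u : ∀ x, E x) (v : Cₛ^∞⟮𝓡 n; V, E⟯) : Prop where
  exists_smul : ∀ x, ∃ t : ℝ, 0 ≤ t ∧ t ≤ 1 ∧ (x ∈ S → t = 0) ∧ v x = t • u x
  map_eq_zero : ∀ x ∉ N, L v x = 0

theorem IsCutoffSolution.mono {L : Cₛ^∞⟮𝓡 n; V, E⟯ →ₗ[ℝ] Cₛ^∞⟮𝓡 n; W, F⟯} {S N N' : Set M}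
    {u : ∀ x, E x} {v : Cₛ^∞⟮𝓡 n; V, E⟯} (h : IsCutoffSolution L S N u v) (hN : N ⊆ N') :
    IsCutoffSolution L S N' u v :=
  ⟨h.exists_smul, fun x hx => h.map_eq_zero x fun h' => hx (hN h')⟩

theorem IsCutoffSolution.norm_trivRep_le {L : Cₛ^∞⟮𝓡 n; V, E⟯ →ₗ[ℝ] Cₛ^∞⟮𝓡 n; W, F⟯} {S N : Set M}
    {u : ∀ x, E x} {v : Cₛ^∞⟮𝓡 n; V, E⟯} (h : IsCutoffSolution L S N u v) {x₀ x : M}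
    (hx : x ∈ (trivializationAt V E x₀).baseSet) {A : ℝ} (hA : 0 ≤ A)
    (hu : x ∉ S → ‖trivRep V u x₀ x‖ ≤ A) : ‖trivRep V v x₀ x‖ ≤ A := by
  obtain ⟨t, ht0, ht1, htS, hv⟩ := h.exists_smul x
  rw [trivRep_smul t u hx hv, norm_smul, Real.norm_of_nonneg ht0]
  -- The values of `u` on `S` are arbitrary, so there the bound comes from the vanishing of the
  -- cutoff.
  by_cases hxS : x ∈ S
  · rw [htS hxS, zero_mul]
    exact hA
  · exact (mul_le_of_le_one_left (norm_nonneg _) ht1).trans (hu hxS)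

omit [ChartedSpace (EuclideanSpace ℝ (Fin n)) M] [IsManifold (𝓡 n) ∞ M]
  [ContMDiffVectorBundle ∞ V E (𝓡 n)] in
theorem mem_baseSet_dual {x₀ x : M} (hx : x ∈ (trivializationAt V E x₀).baseSet) :
    x ∈ (trivializationAt (V →L[ℝ] ℝ) (fun x : M => E x →L[ℝ] Bundle.Trivial M ℝ x) x₀).baseSet :=
  ⟨hx, mem_univ x⟩

/-- Two charts are in play: `c`, in which `L` and the bundles have coordinate expressions, and `e`,
which straightens `S`. The tube estimate is applied in `c`, with `q` the first `m` coordinates of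
`e` read through `c`. `N` is fixed before `v`, so the bound is uniform over all cutoffs. -/
theorem exists_nhds_abs_integral_cutoff_le {vol : Measure M} (hvol : IsSmoothPositiveDensity n vol)
    {L : Cₛ^∞⟮𝓡 n; V, E⟯ →ₗ[ℝ] Cₛ^∞⟮𝓡 n; W, F⟯} {k : ℕ} (hL : IsDiffOpOfOrder L k)
    {S : Set M} (hSclosed : IsClosed S) {m : ℕ} (hS : IsEmbeddedSubmanifoldOfCodim n S m)
    (hm : k + 1 ≤ m) {u : ∀ x, E x} (hu : IsSmoothSectionOn n V u Sᶜ)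
    (hbdd : IsLocallyBoundedNear V u S) {p : M} (hp : p ∈ S) :
    ∃ U : Set M, IsOpen U ∧ p ∈ U ∧ ∀ (f : C^∞⟮𝓡 n, M; 𝓘(ℝ, ℝ), ℝ⟯) (φ : DualSection n W F)
      (K : Set M), tsupport f ⊆ U → IsCompact K → (∀ x ∉ K, φ x = 0) → ∀ ε : ℝ, 0 < ε →
      ∃ N : Set M, IsOpen N ∧ S ⊆ N ∧ ∀ v, IsCutoffSolution L S N u v →
        |∫ x, f x * (φ x (L v x) : ℝ) ∂vol| ≤ ε := by
  obtain ⟨e, he, hpe, heS⟩ := hS.2 p hp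
  obtain ⟨a, ha, hLa⟩ := hL p
  set c := chartAt (EuclideanSpace ℝ (Fin n)) p with hc
  have hcm : c ∈ IsManifold.maximalAtlas (𝓡 n) ∞ M := IsManifold.chart_mem_maximalAtlas p
  obtain ⟨ρ, hρ, hρ0, hmap⟩ := hvol c hcm
  set BE := (trivializationAt V E p).baseSet
  set BF := (trivializationAt W F p).baseSet
  set U : Set M := (localDomain n V E p ∩ localDomain n W F p) ∩ e.source with hU
  have hUo : IsOpen U := ((c.open_source.inter (Trivialization.open_baseSet _)).inter
    (c.open_source.inter (Trivialization.open_baseSet _))).inter e.open_source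
  have hUc : U ⊆ c.source := fun x hx => hx.1.1.1
  have hUE : U ⊆ BE := fun x hx => hx.1.1.2
  have hUF : U ⊆ BF := fun x hx => hx.1.2.2
  have hUe : U ⊆ e.source := fun x hx => hx.2
  refine ⟨U, hUo, ⟨⟨⟨mem_chart_source _ p, mem_baseSet_trivializationAt V E p⟩,
    mem_chart_source _ p, mem_baseSet_trivializationAt W F p⟩, hpe⟩, ?_⟩
  intro f φ K hfU hK hφ ε hε
  set O : Set (EuclideanSpace ℝ (Fin n)) := c.target ∩ c.symm ⁻¹' U with hOdef
  have hO : IsOpen O := c.isOpen_inter_preimage_symm hUo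
  have hOa : O ⊆ c '' (localDomain n V E p ∩ localDomain n W F p) := fun y hy =>
    ⟨c.symm y, hy.2.1, c.right_inv hy.1⟩
  set K₁ := tsupport f ∩ K with hK₁def
  have hK₁ : IsCompact K₁ := hK.inter_left (isClosed_tsupport f)
  have hK₁U : K₁ ⊆ U := inter_subset_left.trans hfU
  set Z := c '' K₁ with hZdef
  have hZ : IsCompact Z := hK₁.image_of_continuousOn (c.continuousOn.mono (hK₁U.trans hUc))
  have hZO : Z ⊆ O := by
    rintro _ ⟨x, hx, rfl⟩
    refine ⟨c.map_source (hUc (hK₁U hx)), ?_⟩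
    rw [mem_preimage, c.left_inv (hUc (hK₁U hx))]
    exact hK₁U hx
  have hOZ : ∀ y ∈ O, y ∉ Z → c.symm y ∉ K₁ := fun y hy hyZ hyK =>
    hyZ ⟨_, hyK, c.right_inv hy.1⟩
  have hsymm : ContMDiffOn (𝓡 n) (𝓡 n) ∞ c.symm O :=
    (contMDiffOn_symm_of_mem_maximalAtlas hcm).mono inter_subset_left
  have hf : ContDiffOn ℝ ∞ (fun y => f (c.symm y)) O :=
    contMDiffOn_iff_contDiffOn.mp (f.contMDiff.comp_contMDiffOn hsymm)
  have hφr : ContDiffOn ℝ ∞ (localRep n (W →L[ℝ] ℝ) φ p) O :=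
    ((φ.isSmoothSectionOn univ).contDiffOn_localRep isOpen_univ p).mono fun y hy =>
      ⟨hy.1, mem_univ _, mem_baseSet_dual (hUF hy.2)⟩
  have hfφ : ∀ x ∈ U, x ∉ K₁ → f x = 0 ∨ trivRep (W →L[ℝ] ℝ) φ p x = 0 := by
    intro x hxU hx
    by_cases hxf : x ∈ tsupport f
    · right
      have h0 := hφ x fun h => hx ⟨hxf, h⟩
      rw [trivRep_smul 0 φ (x₀ := p) (mem_baseSet_dual (hUF hxU)) (by rw [h0, zero_smul]), zero_smul]
    · exact Or.inl (image_eq_zero_of_notMem_tsupport hxf)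
  -- Density, localizing function, test section and coefficient of `L` are merged into one
  -- scalar-valued coefficient.
  let b₀ : ∀ j : ℕ, EuclideanSpace ℝ (Fin n) → (EuclideanSpace ℝ (Fin n) [×j]→L[ℝ] V) →L[ℝ] ℝ :=
    fun j y => (ρ y * f (c.symm y)) • (localRep n (W →L[ℝ] ℝ) φ p y ∘L a j y)
  have hb₀ : ∀ j, ContDiffOn ℝ ∞ (b₀ j) O := fun j =>
    ((hρ.mono inter_subset_left).mul hf).smul_dual (hφr.clm_comp ((ha j).mono hOa))
  have hb₀Z : ∀ j, ∀ y ∈ O, y ∉ Z → b₀ j y = 0 := by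
    intro j y hy hyZ
    rcases hfφ _ hy.2 (hOZ y hy hyZ) with h | h
    · simp only [b₀, h, mul_zero, zero_smul]
    · change (ρ y * f (c.symm y)) • (trivRep (W →L[ℝ] ℝ) φ p (c.symm y) ∘L a j y) = 0
      rw [h, ContinuousLinearMap.zero_comp, smul_zero]
  let b := fun j => O.indicator (b₀ j)
  have hbZ : ∀ j, ∀ y ∉ Z, b j y = 0 := fun j y hy => by
    by_cases hyO : y ∈ O
    · simp only [b, indicator_of_mem hyO, hb₀Z j y hyO hy]
    · simp only [b, indicator_of_notMem hyO]
  have hb : ∀ j, ContDiff ℝ ∞ (b j) := fun j =>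
    (hb₀ j).contDiff_indicator hO hZ.isClosed hZO (hb₀Z j)
  have hq : ContDiffOn ℝ ∞ (fun y => firstCoords hS.1 (e (c.symm y))) O :=
    (firstCoords hS.1).contDiff.comp_contDiffOn (contMDiffOn_iff_contDiffOn.mp
      ((contMDiffOn_of_mem_maximalAtlas he).comp hsymm fun y hy => hUe hy.2))
  obtain ⟨A, hA0, hA⟩ := hbdd.exists_norm_trivRep_le hSclosed hu hK₁ (hK₁U.trans hUE)
  obtain ⟨C, hC0, hC⟩ := exists_abs_integral_diffOp_le_of_tube k hO hZ hZO b hb hbZ hq hA0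
  obtain ⟨C₁, hC₁, h₁⟩ := hvol.exists_measure_comparison hcm hK₁ (hK₁U.trans hUc)
  obtain ⟨C₂, hC₂, h₂⟩ := hvol.exists_measure_tube_le he hK₁ (hK₁U.trans hUe) hS.1
  -- The tube is straight only in `e`: its volume in `c` is bounded by its `vol`, and that by its
  -- volume in `e`.
  have htube : ∀ δ : ℝ, 0 ≤ δ → volume.real (Z ∩ {y | ‖firstCoords hS.1 (e (c.symm y))‖ ≤ δ}) ≤
      (C₁ * C₂).toReal * δ ^ m := by
    intro δ hδ
    obtain ⟨hmeas, hle⟩ := h₂ δ hδ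
    have h3 := (h₁ _ inter_subset_left hmeas).2.trans (mul_le_mul_right hle C₁)
    rw [← mul_assoc] at h3
    have hsub : Z ∩ {y | ‖firstCoords hS.1 (e (c.symm y))‖ ≤ δ} ⊆
        c.target ∩ c.symm ⁻¹' (K₁ ∩ {x | ‖firstCoords hS.1 (e x)‖ ≤ δ}) := by
      rintro _ ⟨⟨x, hx, rfl⟩, hyδ⟩
      refine ⟨c.map_source (hUc (hK₁U hx)), ?_, hyδ⟩
      rw [c.left_inv (hUc (hK₁U hx))]
      exact hx
    have h4 := ENNReal.toReal_mono
      (ENNReal.mul_ne_top (ENNReal.mul_ne_top hC₁ hC₂) (ENNReal.pow_ne_top ENNReal.ofReal_ne_top))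
      ((measure_mono hsub).trans h3)
    rw [ENNReal.toReal_mul, ENNReal.toReal_pow, ENNReal.toReal_ofReal hδ] at h4
    exact h4
  set B := C * (C₁ * C₂).toReal with hBdef
  have hB0 : 0 ≤ B := mul_nonneg hC0 ENNReal.toReal_nonneg
  -- The final bound is `C δ⁻ᵏ` times a constant multiple of `δ ^ (k + 1)`, that is `B * δ`.
  -- Dividing by `B + 1` covers `B = 0`.
  obtain ⟨δ, hδ0, hδ1, hδε⟩ : ∃ δ : ℝ, 0 < δ ∧ δ ≤ 1 ∧ B * δ ≤ ε := by
    refine ⟨min 1 (ε / (B + 1)), lt_min one_pos (by positivity), min_le_left _ _, ?_⟩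
    calc B * min 1 (ε / (B + 1)) ≤ (B + 1) * (ε / (B + 1)) :=
          mul_le_mul (by linarith) (min_le_right _ _) (by positivity) (by positivity)
      _ = ε := by field_simp
  -- `N` must contain all of `S`, also outside the charts. Off `K₁` the product of `f` and `φ`
  -- vanishes, so `K₁ᶜ` can be included for free; inside `K₁` only the `δ / 2`-tube remains.
  refine ⟨K₁ᶜ ∪ (U ∩ (fun x => ‖firstCoords hS.1 (e x)‖) ⁻¹' Iio (δ / 2)), ?_, ?_, ?_⟩
  · refine hK₁.isClosed.isOpen_compl.union (ContinuousOn.isOpen_inter_preimage ?_ hUo isOpen_Iio)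
    exact ((firstCoords hS.1).continuous.comp_continuousOn (e.continuousOn.mono hUe)).norm
  · intro x hxS
    by_cases hx : x ∈ K₁
    · refine Or.inr ⟨hK₁U hx, ?_⟩
      rw [mem_preimage, (firstCoords_eq_zero_iff hS.1 _).mpr ((heS x (hUe (hK₁U hx))).mp hxS),
        norm_zero]
      exact half_pos hδ0
    · exact Or.inl hx
  intro v hv
  have hw : ContDiffOn ℝ ∞ (localRep n V v p) O :=
    ((v.isSmoothSectionOn univ).contDiffOn_localRep isOpen_univ p).mono fun y hy =>
      ⟨hy.1, mem_univ _, hUE hy.2⟩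
  have hrep : ∀ y ∈ O, ∑ j ∈ Finset.range (k + 1), b j y (iteratedFDeriv ℝ j (localRep n V v p) y) =
      ρ y * (f (c.symm y) * (φ (c.symm y) (L v (c.symm y)) : ℝ)) := by
    intro y hy
    have hy' := hLa v y (hOa hy)
    rw [pairing_eq_trivRep φ (L v) (hUF hy.2)]
    change _ = ρ y * (f (c.symm y) * localRep n (W →L[ℝ] ℝ) φ p y (localRep n W (L v) p y))
    rw [hy', map_sum, Finset.mul_sum, Finset.mul_sum]
    refine Finset.sum_congr rfl fun j _ => ?_
    simp only [b, indicator_of_mem hy, b₀]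
    rw [← mul_assoc]
    rfl
  have hint : ∫ x, f x * (φ x (L v x) : ℝ) ∂vol =
      ∫ y, ∑ j ∈ Finset.range (k + 1), b j y (iteratedFDeriv ℝ j (localRep n V v p) y) := by
    have hcont : Continuous fun x => f x * (φ x (L v x) : ℝ) :=
      f.contMDiff.continuous.mul (φ.contMDiff_pairing (L v)).continuous
    have hzero : ∀ x ∉ U, f x = 0 := fun x hx =>
      image_eq_zero_of_notMem_tsupport fun h => hx (hfU h)
    rw [integral_eq_integral_chart hρ.continuousOn hρ0 hmap hcont.continuousOn
      fun x hx => by rw [hzero x fun h => hx (hUc h), zero_mul],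
      ← integral_indicator c.open_target.measurableSet]
    refine integral_congr_ae (Eventually.of_forall fun y => ?_)
    by_cases hy : y ∈ O
    · simp only [indicator_of_mem hy.1]
      exact (hrep y hy).symm
    · have h0 : ∑ j ∈ Finset.range (k + 1), b j y (iteratedFDeriv ℝ j (localRep n V v p) y) = 0 :=
        Finset.sum_eq_zero fun j _ => by rw [hbZ j y fun h => hy (hZO h)]; rfl
      simp only [h0]
      by_cases hyt : y ∈ c.target
      · rw [indicator_of_mem hyt, hzero _ fun h => hy ⟨hyt, h⟩, zero_mul, mul_zero]
      · rw [indicator_of_notMem hyt]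
  rw [hint]
  refine (hC δ hδ0 hδ1 (localRep n V v p) hw ?_ ?_).trans ?_
  · rintro _ ⟨x, hx, rfl⟩
    rw [localRep_chart _ _ (hUc (hK₁U hx))]
    exact hv.norm_trivRep_le (hUE (hK₁U hx)) hA0 (hA x hx)
  · intro y hy hyδ
    rw [hrep y (hZO hy)]
    obtain ⟨x, hx, rfl⟩ := hy
    have hLv : L v (c.symm (c x)) = 0 := by
      rw [c.left_inv (hUc (hK₁U hx))] at hyδ ⊢
      refine hv.map_eq_zero x ?_
      rintro (h | h)
      · exact h hx
      · exact absurd h.2 (not_lt.mpr hyδ)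
    rw [hLv, map_zero]
    exact (congrArg (ρ (c x) * ·) (mul_zero _)).trans (mul_zero _)
  · calc C * δ⁻¹ ^ k * volume.real (Z ∩ {y | ‖firstCoords hS.1 (e (c.symm y))‖ ≤ δ})
        ≤ C * δ⁻¹ ^ k * ((C₁ * C₂).toReal * δ ^ (k + 1)) := by
          refine mul_le_mul_of_nonneg_left ((htube δ hδ0.le).trans ?_) (by positivity)
          exact mul_le_mul_of_nonneg_left (pow_le_pow_of_le_one hδ0.le hδ1 hm)
            ENNReal.toReal_nonneg
      _ = B * δ := by
          rw [hBdef, pow_succ, inv_pow]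
          field_simp
      _ ≤ ε := hδε

end LocalEstimate

/-! ### Globalization, and identification of the smooth solution with `u` -/

section Extension

variable {n : ℕ} {M : Type*} [TopologicalSpace M] [ChartedSpace (EuclideanSpace ℝ (Fin n)) M]
  [IsManifold (𝓡 n) ∞ M] [T2Space M] [SecondCountableTopology M]
  [MeasurableSpace M] [BorelSpace M]
  {V : Type*} [NormedAddCommGroup V] [NormedSpace ℝ V]
  {E : M → Type*} [TopologicalSpace (TotalSpace V E)] [∀ x, AddCommGroup (E x)]
  [∀ x, Module ℝ (E x)] [∀ x, TopologicalSpace (E x)] [FiberBundle V E] [VectorBundle ℝ V E]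
  [ContMDiffVectorBundle ∞ V E (𝓡 n)]
  {W : Type*} [NormedAddCommGroup W] [NormedSpace ℝ W]
  {F : M → Type*} [TopologicalSpace (TotalSpace W F)] [∀ x, AddCommGroup (F x)]
  [∀ x, Module ℝ (F x)] [∀ x, TopologicalSpace (F x)] [FiberBundle W F] [VectorBundle ℝ W F]
  [ContMDiffVectorBundle ∞ W F (𝓡 n)]

/-- Take `v = χ u` with `χ` equal to `0` near `S`, which makes `v` smooth, and to `1` near the
complement of `N`, so that `v` agrees with `u` near each point there and `L v` vanishes by locality.
-/
theorem exists_isCutoffSolution {L : Cₛ^∞⟮𝓡 n; V, E⟯ →ₗ[ℝ] Cₛ^∞⟮𝓡 n; W, F⟯} {S N : Set M}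
    (hS : IsClosed S) (hN : IsOpen N) (hSN : S ⊆ N) {u : ∀ x, E x}
    (hu : IsSmoothSolutionOn L Sᶜ u) :
    ∃ v, IsCutoffSolution L S N u v ∧ ∀ x ∉ N, v x = u x := by
  have : LocallyCompactSpace M := ChartedSpace.locallyCompactSpace (EuclideanSpace ℝ (Fin n)) M
  obtain ⟨χ, hχ0, hχ1, hχ⟩ := exists_contMDiffMap_zero_one_nhds_of_isClosed (𝓡 n) (n := ⊤) hS
    hN.isClosed_compl (disjoint_compl_right_iff_subset.mpr hSN)
  have hts : tsupport χ ⊆ Sᶜ := fun x hx hxS =>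
    notMem_tsupport_iff_eventuallyEq.mpr (eventually_nhdsSet_iff_forall.mp hχ0 x hxS) hx
  refine ⟨⟨fun x => χ x • u x, ContMDiffOn.smul_section_of_tsupport
    (χ.contMDiff.contMDiffOn) hS.isOpen_compl hts hu.1⟩, ⟨fun x => ?_, fun x hx => ?_⟩, ?_⟩
  · exact ⟨χ x, (hχ x).1, (hχ x).2, fun hxS => hχ0.self_of_nhdsSet x hxS, rfl⟩
  · refine hu.2 x (fun h => hx (hSN h)) _ ?_
    filter_upwards [eventually_nhdsSet_iff_forall.mp hχ1 x hx] with y hy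
    change χ y • u y = u y
    rw [hy, one_smul]
  · intro x hx
    change χ x • u x = u x
    rw [hχ1.self_of_nhdsSet x hx, one_smul]

theorem abs_integral_cutoff_le_of_mem_compl {vol : Measure M}
    {L : Cₛ^∞⟮𝓡 n; V, E⟯ →ₗ[ℝ] Cₛ^∞⟮𝓡 n; W, F⟯} {S : Set M} {u : ∀ x, E x}
    (f : C^∞⟮𝓡 n, M; 𝓘(ℝ, ℝ), ℝ⟯) (φ : DualSection n W F)
    {K : Set M} (hf : tsupport f ⊆ Sᶜ) (hK : IsCompact K) (hφ : ∀ x ∉ K, φ x = 0) {ε : ℝ}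
    (hε : 0 < ε) :
    ∃ N : Set M, IsOpen N ∧ S ⊆ N ∧ ∀ v, IsCutoffSolution L S N u v →
      |∫ x, f x * (φ x (L v x) : ℝ) ∂vol| ≤ ε := by
  -- With this largest choice of `N`, `L v` vanishes wherever `f` and `φ` can both be nonzero, so
  -- the integral is exactly zero.
  refine ⟨(tsupport f ∩ K)ᶜ, (hK.inter_left (isClosed_tsupport f)).isClosed.isOpen_compl,
    fun x hx h => hf h.1 hx, fun v hv => ?_⟩
  have : ∀ x, f x * (φ x (L v x) : ℝ) = 0 := by
    intro x
    by_cases hx : x ∈ tsupport f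
    · by_cases hxK : x ∈ K
      · rw [hv.map_eq_zero x fun h => h ⟨hx, hxK⟩, map_zero]
        exact mul_zero _
      · rw [hφ x hxK]
        exact mul_zero _
    · rw [image_eq_zero_of_notMem_tsupport hx, zero_mul]
  simp only [this, integral_zero, abs_zero, hε.le]

/-- A partition of unity over the support of `φ` reduces to the local estimates. Only finitely many
of its members meet `K`, so the corresponding neighborhoods of `S` can be intersected. -/
theorem exists_isOpen_forall_abs_integral_pairing_map_le {vol : Measure M}
    (hvol : IsSmoothPositiveDensity n vol)
    {L : Cₛ^∞⟮𝓡 n; V, E⟯ →ₗ[ℝ] Cₛ^∞⟮𝓡 n; W, F⟯} {k : ℕ} (hL : IsDiffOpOfOrder L k)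
    {S : Set M} (hSclosed : IsClosed S) {m : ℕ} (hS : IsEmbeddedSubmanifoldOfCodim n S m)
    (hm : k + 1 ≤ m) {u : ∀ x, E x} (hu : IsSmoothSectionOn n V u Sᶜ)
    (hbdd : IsLocallyBoundedNear V u S) (φ : DualSection n W F) {K : Set M} (hK : IsCompact K)
    (hφ : ∀ x ∉ K, φ x = 0) {ε : ℝ} (hε : 0 < ε) :
    ∃ N : Set M, IsOpen N ∧ S ⊆ N ∧ ∀ v, IsCutoffSolution L S N u v →
      |∫ x, (φ x (L v x) : ℝ) ∂vol| ≤ ε := by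
  have : LocallyCompactSpace M := ChartedSpace.locallyCompactSpace (EuclideanSpace ℝ (Fin n)) M
  have : IsLocallyFiniteMeasure vol := hvol.isLocallyFiniteMeasure
  have hloc : ∀ p : M, ∃ U : Set M, IsOpen U ∧ p ∈ U ∧ ∀ f : C^∞⟮𝓡 n, M; 𝓘(ℝ, ℝ), ℝ⟯,
      tsupport f ⊆ U → ∀ ε : ℝ, 0 < ε → ∃ N : Set M, IsOpen N ∧ S ⊆ N ∧
        ∀ v, IsCutoffSolution L S N u v → |∫ x, f x * (φ x (L v x) : ℝ) ∂vol| ≤ ε := by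
    intro p
    by_cases hp : p ∈ S
    · obtain ⟨U, hU, hpU, h⟩ :=
        exists_nhds_abs_integral_cutoff_le hvol hL hSclosed hS hm hu hbdd hp
      exact ⟨U, hU, hpU, fun f hf => h f φ K hf hK hφ⟩
    · exact ⟨Sᶜ, hSclosed.isOpen_compl, hp, fun f hf ε hε =>
        abs_integral_cutoff_le_of_mem_compl f φ hf hK hφ hε⟩
  choose U hU hpU h using hloc
  obtain ⟨g, hg⟩ := SmoothPartitionOfUnity.exists_isSubordinate (𝓡 n) hK.isClosed U hU
    fun x _ => mem_iUnion.mpr ⟨x, hpU x⟩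
  have hfin := g.locallyFinite.finite_nonempty_inter_compact hK
  set t := hfin.toFinset with ht
  have hsum : ∀ x ∈ K, ∑ i ∈ t, g i x = 1 := fun x hx => by
    rw [← g.sum_eq_one hx]
    refine (finsum_eq_sum_of_support_subset _ fun i hi => ?_).symm
    rw [ht, Finite.coe_toFinset]
    exact ⟨x, hi, hx⟩
  have hε' : 0 < ε / (t.card + 1) := by positivity
  choose N hN hSN hNv using fun i => h i (g i) (hg i) (ε / (t.card + 1)) hε'
  refine ⟨⋂ i ∈ t, N i, isOpen_biInter_finset fun i _ => hN i, subset_iInter₂ fun i _ => hSN i,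
    fun v hv => ?_⟩
  have hcont : Continuous fun x => (φ x (L v x) : ℝ) := (φ.contMDiff_pairing (L v)).continuous
  have heq : ∀ x, (φ x (L v x) : ℝ) = ∑ i ∈ t, g i x * (φ x (L v x) : ℝ) := by
    intro x
    rw [← Finset.sum_mul]
    by_cases hx : x ∈ K
    · rw [hsum x hx, one_mul]
    · rw [hφ x hx]
      exact (mul_zero _).symm
  rw [integral_congr_ae (Eventually.of_forall heq), integral_finsetSum _ fun i _ => ?_]
  · refine (Finset.abs_sum_le_sum_abs _ _).trans ((Finset.sum_le_sum fun i hi =>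
      hNv i v (hv.mono (biInter_subset_of_mem (t := N) hi))).trans ?_)
    rw [Finset.sum_const, nsmul_eq_mul]
    calc (t.card : ℝ) * (ε / (t.card + 1)) ≤ (t.card + 1) * (ε / (t.card + 1)) := by
          exact mul_le_mul_of_nonneg_right (le_add_of_nonneg_right zero_le_one) hε'.le
      _ = ε := by rw [mul_div_assoc', mul_div_cancel_left₀ _ (Nat.cast_add_one_ne_zero _)]
  · refine ((g i).contMDiff.continuous.mul hcont).integrable_of_hasCompactSupport
      (HasCompactSupport.intro hK fun x hx => ?_)
    change g i x * (φ x (L v x) : ℝ) = 0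
    rw [hφ x hx]
    exact mul_zero _

/-- The finite measure with density `‖f‖` is outer regular and gives `S` mass zero. -/
theorem MeasureTheory.Integrable.exists_isOpen_setIntegral_norm_le
    [TopologicalSpace.PseudoMetrizableSpace M] {vol : Measure M} {f : M → ℝ} (hf : Integrable f vol)
    {S : Set M} (hS : vol S = 0) {ε : ℝ} (hε : 0 < ε) :
    ∃ N : Set M, IsOpen N ∧ S ⊆ N ∧ ∫ x in N, ‖f x‖ ∂vol ≤ ε := by
  have hfin : IsFiniteMeasure (vol.withDensity fun x => ‖f x‖ₑ) :=
    isFiniteMeasure_withDensity hf.2.ne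
  have h0 : (vol.withDensity fun x => ‖f x‖ₑ) S = 0 := withDensity_absolutelyContinuous _ _ hS
  obtain ⟨N, hSN, hN, hlt⟩ := S.exists_isOpen_lt_of_lt (μ := vol.withDensity fun x => ‖f x‖ₑ)
    (ENNReal.ofReal ε) (by rw [h0]; exact ENNReal.ofReal_pos.mpr hε)
  refine ⟨N, hN, hSN, ?_⟩
  rw [withDensity_apply _ hN.measurableSet] at hlt
  rw [integral_norm_eq_lintegral_enorm hf.1.restrict]
  exact ENNReal.toReal_le_of_le_ofReal hε.le hlt.le

theorem integral_pairing_eq_zero_of_isFormalDualValue {vol : Measure M}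
    (hvol : IsSmoothPositiveDensity n vol)
    {L : Cₛ^∞⟮𝓡 n; V, E⟯ →ₗ[ℝ] Cₛ^∞⟮𝓡 n; W, F⟯} {k : ℕ} (hL : IsDiffOpOfOrder L k)
    {S : Set M} (hSclosed : IsClosed S) {m : ℕ} (hS : IsEmbeddedSubmanifoldOfCodim n S m)
    (hm : k + 1 ≤ m) {u : ∀ x, E x} (hu : IsSmoothSolutionOn L Sᶜ u)
    (hbdd : IsLocallyBoundedNear V u S) {φ : DualSection n W F} {K : Set M} (hK : IsCompact K)
    (hφ : ∀ x ∉ K, φ x = 0) {ψ : DualSection n V E} {K' : Set M} (hK' : IsCompact K')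
    (hψ : ∀ x ∉ K', ψ x = 0) (hdual : IsFormalDualValue vol L φ ψ) :
    ∫ x, (ψ x (u x) : ℝ) ∂vol = 0 := by
  have : LocallyCompactSpace M := ChartedSpace.locallyCompactSpace (EuclideanSpace ℝ (Fin n)) M
  have : IsLocallyFiniteMeasure vol := hvol.isLocallyFiniteMeasure
  have : TopologicalSpace.MetrizableSpace M :=
    TopologicalSpace.metrizableSpace_of_t3_secondCountable M
  have hS0 : vol S = 0 := hvol.measure_submanifold_eq_zero hS (by omega)
  have hint := hbdd.integrable_pairing hSclosed hS0 hu.1 ψ hK' hψ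
  rw [← abs_nonpos_iff]
  refine le_of_forall_pos_le_add fun ε hε => ?_
  obtain ⟨N₁, hN₁, hSN₁, h₁⟩ := exists_isOpen_forall_abs_integral_pairing_map_le hvol hL hSclosed
    hS hm hu.1 hbdd φ hK hφ (half_pos hε)
  obtain ⟨N₂, hN₂, hSN₂, h₂⟩ := hint.exists_isOpen_setIntegral_norm_le hS0 (half_pos hε)
  obtain ⟨v, hv, hvu⟩ := exists_isCutoffSolution hSclosed (hN₁.inter hN₂)
    (subset_inter hSN₁ hSN₂) hu
  have hintv : Integrable (fun x => (ψ x (v x) : ℝ)) vol :=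
    (ψ.contMDiff_pairing v).continuous.integrable_of_hasCompactSupport
      (HasCompactSupport.intro hK' fun x hx => by rw [hψ x hx]; rfl)
  -- Duality applies to the globally smooth `v` but not to `u`; the error `u - v` is `(1 - t) u` on
  -- the small neighborhood and zero off it.
  have hsplit : ∫ x, (ψ x (u x) : ℝ) ∂vol = ∫ x, (φ x (L v x) : ℝ) ∂vol +
      ∫ x, ((ψ x (u x) : ℝ) - (ψ x (v x) : ℝ)) ∂vol := by
    rw [integral_sub hint hintv, hdual v]
    ring
  have hbound : ∀ x, ‖(ψ x (u x) : ℝ) - (ψ x (v x) : ℝ)‖ ≤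
      N₂.indicator (fun x => ‖(ψ x (u x) : ℝ)‖) x := by
    intro x
    by_cases hx : x ∈ N₁ ∩ N₂
    · obtain ⟨t, ht0, ht1, -, hvt⟩ := hv.exists_smul x
      rw [indicator_of_mem hx.2, hvt, map_smul]
      change ‖(ψ x (u x) : ℝ) - t * (ψ x (u x) : ℝ)‖ ≤ _
      rw [← one_sub_mul, norm_mul, Real.norm_of_nonneg (by linarith)]
      exact mul_le_of_le_one_left (norm_nonneg _) (by linarith)
    · rw [hvu x hx, sub_self, norm_zero]
      exact indicator_nonneg (fun _ _ => norm_nonneg _) x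
  have hdiff : |∫ x, ((ψ x (u x) : ℝ) - (ψ x (v x) : ℝ)) ∂vol| ≤ ε / 2 := by
    refine (norm_integral_le_of_norm_le (hint.norm.indicator hN₂.measurableSet)
      (Eventually.of_forall hbound)).trans ?_
    rw [integral_indicator hN₂.measurableSet]
    exact h₂
  rw [hsplit, zero_add]
  refine (abs_add_le _ _).trans ?_
  have := h₁ v (hv.mono inter_subset_left)
  linarith

theorem ContMDiffSection.eq_zero_of_dense {s : Cₛ^∞⟮𝓡 n; V, E⟯} {A : Set M} (hA : Dense A)
    (h : ∀ x ∈ A, s x = 0) : s = 0 := by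
  ext p
  change s p = 0
  have hc : ContinuousAt (trivRep V s p) p :=
    ((s.isSmoothSectionOn univ).contMDiffOn_trivRep isOpen_univ p).continuousOn.continuousAt
      ((isOpen_univ.inter (Trivialization.open_baseSet _)).mem_nhds
        ⟨mem_univ _, mem_baseSet_trivializationAt V E p⟩)
  refine eq_zero_of_trivRep_eq_zero (V := V) s (mem_baseSet_trivializationAt V E p) ?_
  by_contra hne
  have hev := (hc.eventually_ne hne).and ((trivializationAt V E p).open_baseSet.mem_nhds
    (mem_baseSet_trivializationAt V E p))
  obtain ⟨x, ⟨hx, hxb⟩, hxA⟩ := (mem_closure_iff_nhds.mp (hA p)) _ hev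
  refine hx ?_
  rw [trivRep_smul 0 s hxb (by rw [h x hxA, zero_smul]), zero_smul]

/-- The section of the dual bundle which is the constant functional `ℓ` in the preferred
trivialization at `p`. -/
def constDual (V : Type*) [NormedAddCommGroup V] [NormedSpace ℝ V]
    (E : M → Type*) [TopologicalSpace (TotalSpace V E)] [∀ x, AddCommGroup (E x)]
    [∀ x, Module ℝ (E x)] [∀ x, TopologicalSpace (E x)] [FiberBundle V E] [VectorBundle ℝ V E]
    (p : M) (l : V →L[ℝ] ℝ) : ∀ x, E x →L[ℝ] Bundle.Trivial M ℝ x :=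
  fun x => l ∘L (trivializationAt V E p).continuousLinearMapAt ℝ x

theorem constDual_apply {p x : M} (l : V →L[ℝ] ℝ) (s : ∀ x, E x)
    (hx : x ∈ (trivializationAt V E p).baseSet) :
    (constDual V E p l x (s x) : ℝ) = l (trivRep V s p x) :=
  congrArg l ((trivializationAt V E p).continuousLinearMapAt_apply_of_mem (R := ℝ) hx _)

theorem isSmoothSectionOn_constDual (p : M) (l : V →L[ℝ] ℝ) :
    IsSmoothSectionOn n (V →L[ℝ] ℝ) (constDual V E p l) (trivializationAt V E p).baseSet := by
  refine ((trivializationAt (V →L[ℝ] ℝ) (fun x : M => E x →L[ℝ] Bundle.Trivial M ℝ x)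
    p).contMDiffOn_section_iff (trivializationAt V E p).open_baseSet
    fun x hx => mem_baseSet_dual hx).mpr ?_
  refine (contMDiffOn_const (c := l)).congr fun x hx => ?_
  ext z
  classical
  -- The pairing formula concerns sections, so an arbitrary vector `z` is realized by a section, not
  -- necessarily continuous, supported at the single point `x`.
  have h := pairing_eq_trivRep (constDual V E p l)
    (Function.update (0 : ∀ x, E x) x ((trivializationAt V E p).symm x z)) hx
  have h1 : trivRep V (Function.update (0 : ∀ x, E x) x ((trivializationAt V E p).symm x z)) p x =
      z := by
    simp only [trivRep, Function.update_self, TotalSpace.mk']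
    rw [Trivialization.apply_mk_symm _ hx]
  rw [constDual_apply l _ hx, h1] at h
  exact h.symm

/-- If `w = s - u` is nonzero at `p`, some functional `l` is positive on it near `p`. Testing with
`l` times a bump function supported there gives a positive integral, since `vol` charges open sets.
-/
theorem eq_of_forall_integral_pairing_eq {vol : Measure M} [IsLocallyFiniteMeasure vol]
    [vol.IsOpenPosMeasure] {S : Set M} (hS : IsClosed S) (hS0 : vol S = 0) {u : ∀ x, E x}
    (hu : IsSmoothSectionOn n V u Sᶜ) (hbdd : IsLocallyBoundedNear V u S)
    (s : Cₛ^∞⟮𝓡 n; V, E⟯)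
    (h : ∀ φ : TestSection n V E univ,
      ∫ x, (φ.1 x (u x) : ℝ) ∂vol = ∫ x, (φ.1 x (s x) : ℝ) ∂vol) :
    ∀ p ∉ S, s p = u p := by
  intro p hp
  by_contra hne
  let w : ∀ x, E x := fun x => s x - u x
  have hw : IsSmoothSectionOn n V w Sᶜ := (s.isSmoothSectionOn Sᶜ).sub_section hu
  set e := trivializationAt V E p with he
  have hpe : p ∈ e.baseSet := mem_baseSet_trivializationAt V E p
  have hwp : trivRep V w p p ≠ 0 := fun h0 =>
    hne (sub_eq_zero.mp (eq_zero_of_trivRep_eq_zero (V := V) w hpe h0))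
  obtain ⟨l, hl⟩ := SeparatingDual.exists_eq_one (R := ℝ) hwp
  have hO : IsOpen (Sᶜ ∩ e.baseSet) := hS.isOpen_compl.inter e.open_baseSet
  have hcw : ContinuousOn (fun x => l (trivRep V w p x)) (Sᶜ ∩ e.baseSet) :=
    l.continuous.comp_continuousOn (hw.contMDiffOn_trivRep hS.isOpen_compl p).continuousOn
  have hpos : ∀ᶠ x in 𝓝 p, 0 < l (trivRep V w p x) :=
    (hcw.continuousAt (hO.mem_nhds ⟨hp, hpe⟩)).eventually (lt_mem_nhds (one_pos.trans_eq hl.symm))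
  obtain ⟨f, -, hf⟩ := (SmoothBumpFunction.nhds_basis_tsupport (I := 𝓡 n) p).mem_iff.mp
    (inter_mem hpos (hO.mem_nhds ⟨hp, hpe⟩))
  have hfb : tsupport f ⊆ e.baseSet := fun x hx => (hf hx).2.2
  let φ₀ : DualSection n V E := ⟨fun x => f x • constDual V E p l x,
    ContMDiffOn.smul_section_of_tsupport f.contMDiff.contMDiffOn e.open_baseSet hfb
      (isSmoothSectionOn_constDual p l)⟩
  have hφ₀ : ∀ x ∉ tsupport f, φ₀ x = 0 := fun x hx => by
    change f x • constDual V E p l x = 0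
    rw [image_eq_zero_of_notMem_tsupport hx, zero_smul]
  have hK : IsCompact (tsupport f) := f.hasCompactSupport
  have hφ := h ⟨φ₀, tsupport f, hK, subset_univ _, hφ₀⟩
  have hval : ∀ x, (φ₀ x (s x) : ℝ) - (φ₀ x (u x) : ℝ) = f x * l (trivRep V w p x) := by
    intro x
    by_cases hx : x ∈ tsupport f
    · rw [← constDual_apply l w (hfb hx)]
      exact (map_sub (φ₀ x) (s x) (u x)).symm
    · rw [hφ₀ x hx, image_eq_zero_of_notMem_tsupport hx, zero_mul]
      exact sub_self _
  have hsub : ∫ x, f x * l (trivRep V w p x) ∂vol = 0 := by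
    simp_rw [← hval]
    rw [integral_sub ((φ₀.contMDiff_pairing s).continuous.integrable_of_hasCompactSupport
      (HasCompactSupport.intro hK fun x hx => by rw [hφ₀ x hx]; rfl))
      (hbdd.integrable_pairing hS hS0 hu φ₀ hK hφ₀)]
    exact sub_eq_zero.mpr hφ.symm
  have hcont : Continuous fun x => f x * l (trivRep V w p x) := by
    refine continuous_of_tsupport fun x hx => ?_
    have hx' : x ∈ tsupport f := closure_mono (fun y hy => left_ne_zero_of_mul hy) hx
    exact f.continuous.continuousAt.mul (hcw.continuousAt (hO.mem_nhds (hf hx').2))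
  refine (hcont.integral_pos_of_hasCompactSupport_nonneg_nonzero (μ := vol) (x := p)
    (HasCompactSupport.intro hK fun x hx => ?_) (fun x => ?_) ?_).ne' hsub
  · rw [image_eq_zero_of_notMem_tsupport hx, zero_mul]
  · by_cases hx : x ∈ tsupport f
    · exact mul_nonneg f.nonneg (le_of_lt (hf hx).1)
    · simp [image_eq_zero_of_notMem_tsupport hx]
  · rw [f.eq_one, hl]
    norm_num

end Extension

end

theorem corollary5p2
    {n : ℕ} {M : Type*} [TopologicalSpace M] [ChartedSpace (EuclideanSpace ℝ (Fin n)) M]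
    [IsManifold (𝓡 n) ∞ M] [T2Space M] [SecondCountableTopology M]
    [MeasurableSpace M] [BorelSpace M]
    (vol : Measure M) (hvol : IsSmoothPositiveDensity n vol)
    {V : Type*} [NormedAddCommGroup V] [NormedSpace ℝ V] [FiniteDimensional ℝ V]
    {E : M → Type*} [TopologicalSpace (TotalSpace V E)] [∀ x, AddCommGroup (E x)]
    [∀ x, Module ℝ (E x)] [∀ x, TopologicalSpace (E x)] [FiberBundle V E] [VectorBundle ℝ V E]
    [ContMDiffVectorBundle ∞ V E (𝓡 n)]
    {W : Type*} [NormedAddCommGroup W] [NormedSpace ℝ W] [FiniteDimensional ℝ W]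
    {F : M → Type*} [TopologicalSpace (TotalSpace W F)] [∀ x, AddCommGroup (F x)]
    [∀ x, Module ℝ (F x)] [∀ x, TopologicalSpace (F x)] [FiberBundle W F] [VectorBundle ℝ W F]
    [ContMDiffVectorBundle ∞ W F (𝓡 n)]
    (L : Cₛ^∞⟮𝓡 n; V, E⟯ →ₗ[ℝ] Cₛ^∞⟮𝓡 n; W, F⟯)
    (k : ℕ) (hk : 1 ≤ k) (hL : IsDiffOpOfOrder L k) (hypo : IsWeaklyHypoelliptic vol L)
    (S : Set M) (hSclosed : IsClosed S) (m : ℕ) (hS : IsEmbeddedSubmanifoldOfCodim n S m)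
    (hm : k + 1 ≤ m)
    (u : ∀ x, E x) (hu : IsSmoothSolutionOn L Sᶜ u) (hbdd : IsLocallyBoundedNear V u S) :
    ∃! ubar : Cₛ^∞⟮𝓡 n; V, E⟯, L ubar = 0 ∧ ∀ x ∉ S, ubar x = u x := by 
  have : IsLocallyFiniteMeasure vol := hvol.isLocallyFiniteMeasure
  have : vol.IsOpenPosMeasure := hvol.isOpenPosMeasure
  have hS0 : vol S = 0 := hvol.measure_submanifold_eq_zero hS (by omega)
  have hdense : Dense Sᶜ := Measure.dense_of_ae (measure_eq_zero_iff_ae_notMem.mp hS0)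
  obtain ⟨s, hs, hTs⟩ := hypo univ isOpen_univ
    (distributionOfLocallyBounded vol hSclosed hS0 hu.1 hbdd) (by
      rintro ⟨φ, K, hK, _, hφ⟩ ⟨ψ, K', hK', _, hψ⟩ hdual
      exact integral_pairing_eq_zero_of_isFormalDualValue hvol hL hSclosed hS hm hu hbdd hK hφ hK'
        hψ hdual)
  let ubar : Cₛ^∞⟮𝓡 n; V, E⟯ := ⟨s, contMDiffOn_univ.mp hs⟩
  have hubar : ∀ x ∉ S, ubar x = u x :=
    eq_of_forall_integral_pairing_eq hSclosed hS0 hu.1 hbdd ubar fun φ =>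
      (hTs φ).trans (by rw [Measure.restrict_univ]; rfl)
  -- Off `S` the equation holds by locality, `ubar` agreeing there with `u`; across `S` it follows
  -- from continuity of `L ubar`.
  refine ⟨ubar, ⟨ContMDiffSection.eq_zero_of_dense hdense fun x hx => ?_, hubar⟩, ?_⟩
  · refine hu.2 x hx ubar ?_
    filter_upwards [hSclosed.isOpen_compl.mem_nhds hx] with y hy using hubar y hy
  · rintro u' ⟨-, hu'⟩
    rw [← sub_eq_zero]
    refine ContMDiffSection.eq_zero_of_dense hdense fun x hx => ?_
    change u' x - ubar x = 0
    rw [hu' x hx, hubar x hx, sub_self]
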